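/- **Setting.** A *Bratteli diagram* $B=(\mathscr V,\mathscr E)$ has finite vertex sets $\mathscr V_n$ ($n\ge 0$, $|\mathscr V_0|=1$) and finite edge sets $\mathscr E_n$ ($n\ge 1$), with surjective source and range maps $s:\mathscr E_n\to\mathscr V_{n-1}$ and $r:\mathscr E_n\to\mathscr V_n$. Its path space $X$ consists of the sequences $x_1x_2\cdots$ with $x_i\in\mathscr E_i$ and $r(x_i)=s(x_{i+1})$ for all $i$, with the topology inherited from the product of the discrete spaces $\mathscr E_i$; it is assumed throughout that $X$ is homeomorphic to the Cantor set. An *ordering* $\xi$ assigns to each set $r^{-1}(w)$, $w\in\mathscr V_n$, $n\ge1$, a linear order. Paths $x,y$ satisfy $x<y$ if for some $n$ we have $x_k=y_k$ for all $k>n$ and $x_n<y_n$. The ordered diagram is *properly ordered* if there is exactly one path $x_{\max}$ all of whose edges are maximal and exactly one path $x_{\min}$ all of whose edges are minimal. The *adic system* of a properly ordered diagram is $(X,T)$, where $T:X\to X$ is the homeomorphism that sends each $x\neq x_{\max}$ to the smallest path larger than $x$ and sends $x_{\max}$ to $x_{\min}$. A *telescoping* of $B$ to levels $0=m_0<m_1<m_2<\cdots$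 has vertex sets $\mathscr V_{m_n}$ and, as edges from level $n$ to level $n+1$, the paths of $B$ from $\mathscr V_{m_n}$ to $\mathscr V_{m_{n+1}}$; two such paths with the same range are ordered by comparing the last edges at which they differ. $B$ is *simple* if it has a telescoping in which every vertex is joined by an edge to every vertex of the next level. For $w\in\mathscr V_n$, $n\ge 1$, let $c(w)=s(e_1)\cdots s(e_\ell)$, where $e_1<\dots<e_\ell$ are the edges in $r^{-1}(w)$. Level $n$ is *uniformly ordered* if there is a word $v$ over $\mathscr V_{n-1}$ such that for every $w\in\mathscr V_n$ we have $c(w)=v^{k_w}$ for some $k_w\in\mathbb N$. An *odometer* is a topological dynamical system topologically conjugate to the adic system of an ordered Bratteli diagram with exactly one vertex at every level. **Theorem.** Let $B=(\mathscr V,\mathscr E,\xi)$ be an ordered Bratteli diagram. 1. If $B$ has a telescoping with infinitely many uniformly ordered levels, then $B$ is properly ordered and its adic system is topologically conjugate to an odometer. 2. Conversely, if $B$ is simple and properly ordered and its adic system is topologically conjugate to an odometer, then $B$ has a telescoping with infinitely many uniformly ordered levels. -/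

import Mathlib

universe u

/-- A Bratteli diagram. `V n` is the set of vertices at level `n` and `E n` is the set of edges
with source at level `n` and range at level `n + 1`. Every vertex emits an edge, every vertex not
at level `0` receives an edge, all levels are finite, and level `0` has a single vertex. -/
structure BratteliDiagram where
  V : ℕ → Type u
  E : ℕ → Type u
  src : ∀ n, E n → V n
  rng : ∀ n, E n → V (n + 1)
  src_surjective : ∀ n, Function.Surjective (src n)
  rng_surjective : ∀ n, Function.Surjective (rng n)
  finite_V : ∀ n, Finite (V n)
  finite_E : ∀ n, Finite (E n)
  card_root : Nat.card (V 0) = 1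

namespace BratteliDiagram

/-- The path space: infinite edge paths starting at the root. -/
def PathSpace (B : BratteliDiagram.{u}) : Type u :=
  {x : ∀ n, B.E n // ∀ n, B.rng n (x n) = B.src (n + 1) (x (n + 1))}

/-- The topology in which two paths are close when they agree on a long initial segment: the
subspace topology from the product of the discrete spaces `E n`. -/
instance (B : BratteliDiagram.{u}) : TopologicalSpace B.PathSpace :=
  letI : ∀ n, TopologicalSpace (B.E n) := fun _ => ⊥
  inferInstanceAs
    (TopologicalSpace {x : ∀ n, B.E n // ∀ n, B.rng n (x n) = B.src (n + 1) (x (n + 1))})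

/-- The path space is homeomorphic to the Cantor set. -/
def HasCantorPathSpace (B : BratteliDiagram.{u}) : Prop :=
  Nonempty (B.PathSpace ≃ₜ (ℕ → Bool))

/-- A finite path from level `m` to level `n`, recorded by its vertices at the levels `m, …, n`
and its edges. (For `m < n` the vertices are determined by the edges.) -/
@[ext]
structure FinPath (B : BratteliDiagram.{u}) (m n : ℕ) where
  vert : ∀ i, m ≤ i → i ≤ n → B.V i
  edge : ∀ i, m ≤ i → i < n → B.E i
  src_edge : ∀ i (h₁ : m ≤ i) (h₂ : i < n), B.src i (edge i h₁ h₂) = vert i h₁ h₂.le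
  rng_edge : ∀ i (h₁ : m ≤ i) (h₂ : i < n),
    B.rng i (edge i h₁ h₂) = vert (i + 1) (Nat.le_succ_of_le h₁) h₂

theorem FinPath.ext_edge {B : BratteliDiagram.{u}} {m n : ℕ} (hmn : m < n) {p q : B.FinPath m n}
    (h : ∀ i h₁ h₂, p.edge i h₁ h₂ = q.edge i h₁ h₂) : p = q := by
  have he : p.edge = q.edge := by
    funext i h₁ h₂
    exact h i h₁ h₂
  refine FinPath.ext ?_ he
  funext i h₁ h₂
  rcases Nat.lt_or_ge i n with h3 | h3
  · rw [← p.src_edge i h₁ h3, ← q.src_edge i h₁ h3, h]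
  · obtain rfl : i = n := le_antisymm h₂ h3
    obtain ⟨k, rfl⟩ : ∃ k, i = k + 1 := ⟨i - 1, by omega⟩
    rw [← p.rng_edge k (by omega) (by omega), ← q.rng_edge k (by omega) (by omega), h]

theorem FinPath.finite (B : BratteliDiagram.{u}) (m n : ℕ) : Finite (B.FinPath m n) := by
  have := B.finite_V
  have := B.finite_E
  let f : B.FinPath m n → (∀ i : Set.Icc m n, B.V i) × (∀ i : Set.Ico m n, B.E i) := fun p =>
    (fun i => p.vert i i.2.1 i.2.2, fun i => p.edge i i.2.1 i.2.2)
  refine Finite.of_injective f fun p q hpq => ?_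
  have hv := congrArg Prod.fst hpq
  have he := congrArg Prod.snd hpq
  refine FinPath.ext ?_ ?_
  · funext i h₁ h₂
    exact congrFun hv ⟨i, h₁, h₂⟩
  · funext i h₁ h₂
    exact congrFun he ⟨i, h₁, h₂⟩

theorem FinPath.exists_from (B : BratteliDiagram.{u}) {m n : ℕ} (hmn : m ≤ n) (v : B.V m) :
    ∃ p : B.FinPath m n, p.vert m le_rfl hmn = v := by
  choose e he using B.src_surjective
  refine ⟨⟨fun i h₁ _ => Nat.leRecOn h₁ (fun {k} w => B.rng k (e k w)) v,
    fun i h₁ _ => e i (Nat.leRecOn h₁ (fun {k} w => B.rng k (e k w)) v), ?_, ?_⟩, ?_⟩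
  · intro i h₁ h₂
    exact he _ _
  · intro i h₁ h₂
    exact (Nat.leRecOn_succ (C := B.V) (next := fun {k} w => B.rng k (e k w)) h₁ v).symm
  · exact Nat.leRecOn_self (C := B.V) v

theorem FinPath.exists_to (B : BratteliDiagram.{u}) {m n : ℕ} (hmn : m ≤ n) (w : B.V n) :
    ∃ p : B.FinPath m n, p.vert n hmn le_rfl = w := by
  induction n, hmn using Nat.le_induction with
  | base => exact FinPath.exists_from B le_rfl w
  | succ n hmn ih =>
    obtain ⟨e, he⟩ := B.rng_surjective n w
    obtain ⟨p, hp⟩ := ih (B.src n e)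
    refine ⟨⟨fun i h₁ h₂ => if h : i ≤ n then p.vert i h₁ h else
        (show i = n + 1 by omega) ▸ w,
      fun i h₁ h₂ => if h : i < n then p.edge i h₁ h else (show n = i by omega) ▸ e,
      ?_, ?_⟩, ?_⟩
    · intro i h₁ h₂
      rcases Nat.lt_or_ge i n with h | h
      · simp only [h, h.le, dif_pos]
        exact p.src_edge i h₁ h
      · obtain rfl : i = n := by omega
        simp [hp]
    · intro i h₁ h₂
      rcases Nat.lt_or_ge i n with h | h
      · have h' : i + 1 ≤ n := h
        simp only [h, h', dif_pos]
        exact p.rng_edge i h₁ h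
      · obtain rfl : i = n := by omega
        simp [he]
    · simp

/-- The telescoping of `B` to the levels `0 = φ 0 < φ 1 < φ 2 < ⋯`: the vertices at level `n` are
the vertices of `B` at level `φ n`, and the edges from level `n` to level `n + 1` are the paths
of `B` from level `φ n` to level `φ (n + 1)`. -/
def telescope (B : BratteliDiagram.{u}) (φ : ℕ → ℕ) (hφ : StrictMono φ) (h0 : φ 0 = 0) :
    BratteliDiagram.{u} where
  V n := B.V (φ n)
  E n := B.FinPath (φ n) (φ (n + 1))
  src n p := p.vert (φ n) le_rfl (hφ n.lt_succ_self).le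
  rng n p := p.vert (φ (n + 1)) (hφ n.lt_succ_self).le le_rfl
  src_surjective n := FinPath.exists_from B (hφ n.lt_succ_self).le
  rng_surjective n := FinPath.exists_to B (hφ n.lt_succ_self).le
  finite_V n := B.finite_V (φ n)
  finite_E n := FinPath.finite B (φ n) (φ (n + 1))
  card_root := by rw [h0]; exact B.card_root

/-- A diagram is simple if it has a telescoping in which every vertex is joined by an edge to
every vertex of the next level. -/
def IsSimple (B : BratteliDiagram.{u}) : Prop :=
  ∃ (φ : ℕ → ℕ) (hφ : StrictMono φ) (h0 : φ 0 = 0),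
    ∀ (n : ℕ) (v : (B.telescope φ hφ h0).V n) (w : (B.telescope φ hφ h0).V (n + 1)),
      ∃ e, (B.telescope φ hφ h0).src n e = v ∧ (B.telescope φ hφ h0).rng n e = w

end BratteliDiagram

/-- An ordered Bratteli diagram: the set of edges entering each vertex carries a linear order.
`lt n` is the (strict) partial order on `E n` that is the union of these linear orders. -/
structure OrderedBratteliDiagram extends BratteliDiagram.{u} where
  lt : ∀ n, E n → E n → Prop
  rng_eq_of_lt : ∀ n e f, lt n e f → rng n e = rng n f
  lt_irrefl : ∀ n e, ¬ lt n e e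
  lt_trans : ∀ n e f g, lt n e f → lt n f g → lt n e g
  lt_total : ∀ n e f, rng n e = rng n f → lt n e f ∨ e = f ∨ lt n f e

namespace OrderedBratteliDiagram

/-- The order on finite paths induced by the order on edges: compare the last edges at which the
paths differ. -/
def FinPathLt (B : OrderedBratteliDiagram.{u}) {m n : ℕ}
    (p q : B.toBratteliDiagram.FinPath m n) : Prop :=
  ∃ i h₁ h₂, B.lt i (p.edge i h₁ h₂) (q.edge i h₁ h₂) ∧
    ∀ j (h₃ : m ≤ j) (h₄ : j < n), i < j → p.edge j h₃ h₄ = q.edge j h₃ h₄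

/-- The telescoping of an ordered diagram, with the induced order. -/
def telescope (B : OrderedBratteliDiagram.{u}) (φ : ℕ → ℕ) (hφ : StrictMono φ) (h0 : φ 0 = 0) :
    OrderedBratteliDiagram.{u} where
  toBratteliDiagram := B.toBratteliDiagram.telescope φ hφ h0
  lt _ p q := B.FinPathLt p q
  rng_eq_of_lt n := by
    have hmn : φ n < φ (n + 1) := hφ n.lt_succ_self
    change ∀ p q : B.toBratteliDiagram.FinPath (φ n) (φ (n + 1)), B.FinPathLt p q →
      p.vert _ hmn.le le_rfl = q.vert _ hmn.le le_rfl
    generalize φ n = a at hmn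
    generalize φ (n + 1) = b at hmn
    rintro p q ⟨i, h₁, h₂, hlt, heq⟩
    obtain ⟨k, rfl⟩ : ∃ k, b = k + 1 := ⟨b - 1, by omega⟩
    rw [← p.rng_edge k (by omega) (by omega), ← q.rng_edge k (by omega) (by omega)]
    rcases Nat.lt_or_ge i k with h | h
    · rw [heq k (by omega) (by omega) h]
    · obtain rfl : i = k := by omega
      exact B.rng_eq_of_lt _ _ _ hlt
  lt_irrefl _ p := by
    rintro ⟨i, h₁, h₂, hlt, -⟩
    exact B.lt_irrefl _ _ hlt
  lt_trans _ p q r := by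
    rintro ⟨i, h₁, h₂, hlt, heq⟩ ⟨i', h₁', h₂', hlt', heq'⟩
    rcases lt_trichotomy i i' with h | h | h
    · refine ⟨i', h₁', h₂', ?_, fun j h₃ h₄ hj => ?_⟩
      · rw [heq i' h₁' h₂' h]; exact hlt'
      · rw [heq j h₃ h₄ (h.trans hj), heq' j h₃ h₄ hj]
    · subst h
      exact ⟨i, h₁, h₂, B.lt_trans _ _ _ _ hlt hlt',
        fun j h₃ h₄ hj => (heq j h₃ h₄ hj).trans (heq' j h₃ h₄ hj)⟩
    · refine ⟨i, h₁, h₂, ?_, fun j h₃ h₄ hj => ?_⟩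
      · rw [← heq' i h₁ h₂ h]; exact hlt
      · rw [heq j h₃ h₄ hj, heq' j h₃ h₄ (h.trans hj)]
  lt_total n := by
    have hmn : φ n < φ (n + 1) := hφ n.lt_succ_self
    change ∀ p q : B.toBratteliDiagram.FinPath (φ n) (φ (n + 1)),
      p.vert _ hmn.le le_rfl = q.vert _ hmn.le le_rfl →
      B.FinPathLt p q ∨ p = q ∨ B.FinPathLt q p
    generalize φ n = a at hmn
    generalize φ (n + 1) = b at hmn
    intro p q hpq
    by_cases hall : ∀ i h₁ h₂, p.edge i h₁ h₂ = q.edge i h₁ h₂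
    · exact Or.inr (Or.inl (BratteliDiagram.FinPath.ext_edge hmn hall))
    · have key : ∀ d i (h₁ : a ≤ i) (h₂ : i < b), b ≤ i + d → p.edge i h₁ h₂ ≠ q.edge i h₁ h₂ →
          ∃ k h₁ h₂, p.edge k h₁ h₂ ≠ q.edge k h₁ h₂ ∧
            ∀ j (h₃ : a ≤ j) (h₄ : j < b), k < j → p.edge j h₃ h₄ = q.edge j h₃ h₄ := by
        intro d
        induction d with
        | zero => intro i h₁ h₂ h; omega
        | succ d ih =>
          intro i h₁ h₂ h hne
          by_cases hj : ∀ j (h₃ : a ≤ j) (h₄ : j < b), i < j → p.edge j h₃ h₄ = q.edge j h₃ h₄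
          · exact ⟨i, h₁, h₂, hne, hj⟩
          · push Not at hj
            obtain ⟨j, h₃, h₄, hij, hne'⟩ := hj
            exact ih j h₃ h₄ (by omega) hne'
      push Not at hall
      obtain ⟨i, h₁, h₂, hne⟩ := hall
      obtain ⟨k, h₁, h₂, hne, heq⟩ := key b i h₁ h₂ (by omega) hne
      have hr : B.rng k (p.edge k h₁ h₂) = B.rng k (q.edge k h₁ h₂) := by
        rw [p.rng_edge, q.rng_edge]
        rcases Nat.lt_or_ge (k + 1) b with h | h
        · rw [← p.src_edge (k + 1) (by omega) h, ← q.src_edge (k + 1) (by omega) h,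
            heq (k + 1) (by omega) h k.lt_succ_self]
        · obtain rfl : b = k + 1 := by omega
          exact hpq
      rcases B.lt_total k _ _ hr with h | h | h
      · exact Or.inl ⟨k, h₁, h₂, h, heq⟩
      · exact absurd h hne
      · exact Or.inr (Or.inr ⟨k, h₁, h₂, h, fun j h₃ h₄ hj => (heq j h₃ h₄ hj).symm⟩)

/-- `es` lists the edges entering the vertex `w` in increasing order. -/
def IsOrderedListOfEdgesInto (B : OrderedBratteliDiagram.{u}) (n : ℕ) (w : B.V (n + 1))
    (es : List (B.E n)) : Prop :=
  es.Pairwise (B.lt n) ∧ ∀ e, e ∈ es ↔ B.rng n e = w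

/-- Level `n + 1` is uniformly ordered: there is a word `v` in the vertices of level `n` such that
for every vertex `w` at level `n + 1`, the list of the sources of the edges entering `w`, taken in
increasing order of the edges, is a power `v ^ k` of `v`. -/
def IsUniformlyOrderedLevel (B : OrderedBratteliDiagram.{u}) (n : ℕ) : Prop :=
  ∃ v : List (B.V n), ∀ w : B.V (n + 1), ∃ (es : List (B.E n)) (k : ℕ),
    B.IsOrderedListOfEdgesInto n w es ∧ es.map (B.src n) = (List.replicate k v).flatten

/-- Some telescoping has infinitely many uniformly ordered levels. -/
def HasUniformlyOrderedTelescoping (B : OrderedBratteliDiagram.{u}) : Prop :=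
  ∃ (φ : ℕ → ℕ) (hφ : StrictMono φ) (h0 : φ 0 = 0),
    {n | (B.telescope φ hφ h0).IsUniformlyOrderedLevel n}.Infinite

/-- The partial order on paths: `x < y` if the paths eventually coincide and, at the last place
where they differ, the edge of `x` is smaller. -/
def PathLt (B : OrderedBratteliDiagram.{u}) (x y : B.PathSpace) : Prop :=
  ∃ n, B.lt n (x.1 n) (y.1 n) ∧ ∀ k, n < k → x.1 k = y.1 k

/-- A path all of whose edges are maximal. -/
def IsMaxPath (B : OrderedBratteliDiagram.{u}) (x : B.PathSpace) : Prop :=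
  ∀ n e, ¬ B.lt n (x.1 n) e

/-- A path all of whose edges are minimal. -/
def IsMinPath (B : OrderedBratteliDiagram.{u}) (x : B.PathSpace) : Prop :=
  ∀ n e, ¬ B.lt n e (x.1 n)

/-- There are exactly one maximal and exactly one minimal path. -/
def IsProperlyOrdered (B : OrderedBratteliDiagram.{u}) : Prop :=
  (∃! x, B.IsMaxPath x) ∧ ∃! x, B.IsMinPath x

/-- `T` is the adic (Vershik) homeomorphism: it sends each non-maximal path to the smallest path
larger than it, and maximal paths to minimal paths. In a properly ordered diagram these
conditions determine `T`. -/
def IsAdicHomeomorph (B : OrderedBratteliDiagram.{u}) (T : B.PathSpace ≃ₜ B.PathSpace) : Prop :=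
  (∀ x, ¬ B.IsMaxPath x →
    B.PathLt x (T x) ∧ ∀ y, B.PathLt x y → y = T x ∨ B.PathLt (T x) y) ∧
  ∀ x, B.IsMaxPath x → B.IsMinPath (T x)

/-- The adic systems of `B` and `C` are topologically conjugate. -/
def AdicConjugate (B C : OrderedBratteliDiagram.{u}) : Prop :=
  ∃ (T : B.PathSpace ≃ₜ B.PathSpace) (S : C.PathSpace ≃ₜ C.PathSpace)
    (h : B.PathSpace ≃ₜ C.PathSpace),
    B.IsAdicHomeomorph T ∧ C.IsAdicHomeomorph S ∧ ∀ x, h (T x) = S (h x)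

/-- The adic system of `B` is topologically conjugate to an odometer, that is, to the adic system
of an ordered diagram with exactly one vertex at every level. -/
def IsConjugateToOdometer (B : OrderedBratteliDiagram.{u}) : Prop :=
  ∃ C : OrderedBratteliDiagram.{u}, C.HasCantorPathSpace ∧ (∀ n, Nat.card (C.V n) = 1) ∧
    B.AdicConjugate C

end OrderedBratteliDiagram

/-!
For a path `x` and a level `n`, let `pos n x` be the position of the first `n` edges of `x` among
all paths from the root to the vertex of `x` at level `n`, and let `height n v` be the number of
paths from the root to `v`. The adic map adds `1` to the position as long as the result is less
than the height, and resets the position to `0` otherwise (`IsAdicMap.of_lt`, `IsAdicMap.of_eq`).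
Hence, if `p` divides all heights at level `n`, the position at level `n` modulo `p` is a factor of
the adic system onto the rotation of `ℤ/p` (`IsAdicMap.pos_modEq`).

The combinatorial core is that level `m` is uniformly ordered over level `n` if and only if some
`p > 0` divides all heights at level `m` and the position at level `m` modulo `p` determines the
first `n` edges (`IsUniformlyOrderedBetween.exists_period`, `isUniformlyOrderedBetween_of_period`).
To see this, walk through all paths from the root to `w` at level `m` in increasing order, and
record the pair (vertex at level `n`, position at level `n`) each time. The resulting word is the
concatenation of the words `(v, 0) ⋯ (v, height n v - 1)` over the letters `v` of the word of
sources of `w` (`exists_tower`), so the word of sources of `w` can be recovered from it. The word of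
sources is a power of a fixed word for all `w` if and only if the recorded words are powers of a
fixed word for all `w`, and this is the stated periodicity.

If infinitely many levels of a telescoping are uniformly ordered, one obtains periods
`p₀ ∣ p₁ ∣ ⋯` such that the residues of the positions determine the path (`Periods`). Minimal paths
have residues `0` and maximal paths have residues `-1`, so both are unique, and the residues are the
partial sums of the digits of a point of the odometer with `pₖ₊₁ / pₖ` edges at level `k`. This
gives the conjugacy (`Periods.isConjugateToOdometer`).

Conversely, let `h` be a conjugacy to an odometer. By compactness, the first `n` edges of `x` are
determined by the position `g x` of `h x` at some level of the odometer, which is a function with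
values in some `ℤ/q` that the adic map increases by `1`, and `g` in turn depends on finitely many
edges only. As the minimal and maximal paths are unique, for all large `m` the function `g` has the
value of the minimal (maximal) path on all paths that are minimal (maximal) below level `m`.
Therefore `g x = g xmin + pos m x` modulo `q`, and `q` divides the heights at level `m`
(`exists_isUniformlyOrderedBetween`).
-/

/-! ### Paths and cutting-and-pasting of paths -/

namespace BratteliDiagram

variable {B : BratteliDiagram.{u}}

namespace PathSpace

/-- The vertex at level `n` of a path. -/
def vert (x : B.PathSpace) (n : ℕ) : B.V n := B.src n (x.1 n)

/-- The two paths have the same edges from level `n` on. -/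
def AgreeFrom (n : ℕ) (x y : B.PathSpace) : Prop := ∀ k, n ≤ k → x.1 k = y.1 k

/-- The two paths have the same first `n` edges. -/
def AgreeBelow (n : ℕ) (x y : B.PathSpace) : Prop := ∀ k, k < n → x.1 k = y.1 k

/-- The finite path from level `m` to level `n` contained in an infinite path. -/
def seg (x : B.PathSpace) (m n : ℕ) : B.FinPath m n where
  vert i _ _ := x.vert i
  edge i _ _ := x.1 i
  src_edge _ _ _ := rfl
  rng_edge i _ _ := x.2 i

theorem rng_eq_vert (x : B.PathSpace) (n : ℕ) : B.rng n (x.1 n) = x.vert (n + 1) := x.2 n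

theorem ext {x y : B.PathSpace} (h : ∀ k, x.1 k = y.1 k) : x = y := Subtype.ext (funext h)

theorem AgreeFrom.refl (n : ℕ) (x : B.PathSpace) : AgreeFrom n x x := fun _ _ => rfl

theorem AgreeFrom.symm {n : ℕ} {x y : B.PathSpace} (h : AgreeFrom n x y) : AgreeFrom n y x :=
  fun k hk => (h k hk).symm

theorem AgreeFrom.trans {n : ℕ} {x y z : B.PathSpace} (h : AgreeFrom n x y)
    (h' : AgreeFrom n y z) : AgreeFrom n x z := fun k hk => (h k hk).trans (h' k hk)

theorem AgreeFrom.mono {m n : ℕ} (hmn : m ≤ n) {x y : B.PathSpace} (h : AgreeFrom m x y) :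
    AgreeFrom n x y := fun k hk => h k (hmn.trans hk)

theorem AgreeFrom.vert_eq {n : ℕ} {x y : B.PathSpace} (h : AgreeFrom n x y) {k : ℕ} (hk : n ≤ k) :
    x.vert k = y.vert k := by rw [vert, vert, h k hk]

theorem AgreeBelow.symm {n : ℕ} {x y : B.PathSpace} (h : AgreeBelow n x y) : AgreeBelow n y x :=
  fun k hk => (h k hk).symm

theorem AgreeBelow.trans {n : ℕ} {x y z : B.PathSpace} (h : AgreeBelow n x y)
    (h' : AgreeBelow n y z) : AgreeBelow n x z := fun k hk => (h k hk).trans (h' k hk)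

theorem AgreeBelow.mono {m n : ℕ} (hmn : m ≤ n) {x y : B.PathSpace} (h : AgreeBelow n x y) :
    AgreeBelow m x y := fun k hk => h k (hk.trans_le hmn)

/-- The first `n` edges of a path determine its vertex at level `n`; for `n = 0` this is because
there is only one vertex at level `0`. -/
theorem AgreeBelow.vert_eq {n : ℕ} {x y : B.PathSpace} (h : AgreeBelow n x y) {k : ℕ}
    (hk : k ≤ n) : x.vert k = y.vert k := by
  cases k with
  | zero =>
    have := (Nat.card_eq_one_iff_unique.1 B.card_root).1
    exact Subsingleton.elim _ _
  | succ k => rw [← rng_eq_vert, ← rng_eq_vert, h k hk]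

theorem eq_of_agree {n : ℕ} {x y : B.PathSpace} (h : AgreeBelow n x y) (h' : AgreeFrom n x y) :
    x = y := ext fun k => (Nat.lt_or_ge k n).elim (h k) (h' k)

open Classical in
/-- The path that follows `y` below level `n` and `x` from level `n` on. If the two paths have
different vertices at level `n`, the value is `x`. -/
noncomputable def splice (n : ℕ) (y x : B.PathSpace) : B.PathSpace :=
  if h : y.vert n = x.vert n then
    ⟨fun k => if k < n then y.1 k else x.1 k, by
      intro k
      rcases lt_trichotomy (k + 1) n with hk | hk | hk
      · simp only [hk, (k.lt_succ_self.trans hk), if_true]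
        exact y.2 k
      · subst hk
        simp only [k.lt_succ_self, if_true, lt_irrefl, if_false]
        exact (y.2 k).trans h
      · simp only [not_lt.2 hk.le, not_lt.2 (Nat.lt_succ_iff.1 hk), if_false]
        exact x.2 k⟩
  else x

theorem splice_agreeBelow {n : ℕ} {y x : B.PathSpace} (h : y.vert n = x.vert n) :
    AgreeBelow n (splice n y x) y := by
  intro k hk
  simp [splice, h, hk]

theorem splice_agreeFrom {n : ℕ} {y x : B.PathSpace} (h : y.vert n = x.vert n) :
    AgreeFrom n (splice n y x) x := by
  intro k hk
  simp [splice, h, not_lt.2 hk]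

end PathSpace

open PathSpace

/-- Every vertex lies on an infinite path. -/
theorem exists_path_vert {n : ℕ} (v : B.V n) : ∃ x : B.PathSpace, x.vert n = v := by
  obtain ⟨A, hA⟩ := FinPath.exists_to B (Nat.zero_le n) v
  choose e he using B.src_surjective
  refine ⟨⟨fun k => if h : n ≤ k then e k (Nat.leRecOn h (fun {k} w => B.rng k (e k w)) v) else
    A.edge k k.zero_le (not_le.1 h), ?_⟩, ?_⟩
  · intro k
    rcases lt_trichotomy (k + 1) n with hk | hk | hk
    · have h1 : ¬ n ≤ k := by omega
      simp only [h1, not_le.2 hk, dif_neg, not_false_eq_true]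
      rw [A.rng_edge, A.src_edge]
    · subst hk
      have h1 : ¬ k + 1 ≤ k := by omega
      simp only [h1, le_refl, dif_neg, dif_pos, not_false_eq_true]
      rw [A.rng_edge, he, hA]
      exact (Nat.leRecOn_self (C := B.V) v).symm
    · have h1 : n ≤ k := by omega
      simp only [h1, hk.le, dif_pos]
      rw [he]
      exact (Nat.leRecOn_succ (C := B.V) (next := fun {k} w => B.rng k (e k w)) h1 v).symm
  · simp only [vert, le_refl, dif_pos, he]
    exact Nat.leRecOn_self (C := B.V) v

/-- A finite path can be completed to an infinite one with a prescribed tail. -/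
theorem exists_path_seg {m n : ℕ} (hmn : m < n) (q : B.FinPath m n) (x : B.PathSpace)
    (hx : q.vert n hmn.le le_rfl = x.vert n) :
    ∃ z : B.PathSpace, AgreeFrom n z x ∧ z.seg m n = q := by
  obtain ⟨y, hy⟩ := exists_path_vert (q.vert m le_rfl hmn.le)
  refine ⟨⟨fun k => if h : k < m then y.1 k else if h' : k < n then q.edge k (not_lt.1 h) h' else
    x.1 k, ?_⟩, ?_, ?_⟩
  · intro k
    rcases lt_trichotomy (k + 1) m with hk | hk | hk
    · simp only [hk, k.lt_succ_self.trans hk, dif_pos]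
      exact y.2 k
    · subst hk
      simp only [hmn, k.lt_succ_self, lt_irrefl, dif_neg, dif_pos, not_false_eq_true]
      rw [q.src_edge, ← hy]
      exact y.2 k
    · have h1 : ¬ k < m := by omega
      simp only [not_lt.2 hk.le, h1, dif_neg, not_false_eq_true]
      rcases lt_trichotomy (k + 1) n with hk' | hk' | hk'
      · simp only [hk', k.lt_succ_self.trans hk', dif_pos]
        rw [q.rng_edge, q.src_edge]
      · subst hk'
        simp only [k.lt_succ_self, lt_irrefl, dif_neg, dif_pos, not_false_eq_true]
        rw [q.rng_edge]
        exact hx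
      · have h2 : ¬ k < n := by omega
        simp only [not_lt.2 hk'.le, h2, dif_neg, not_false_eq_true]
        exact x.2 k
  · intro k hk
    have h1 : ¬ k < m := by omega
    simp [h1, not_lt.2 hk]
  · refine FinPath.ext_edge hmn fun i h₁ h₂ => ?_
    simp [seg, not_lt.2 h₁, h₂]

/-- The edge of a path at level `n` can be replaced by any edge with the same range, at the cost of
changing the edges below it. -/
theorem exists_path_edge {n : ℕ} (e : B.E n) (x : B.PathSpace)
    (hx : B.rng n e = x.vert (n + 1)) :
    ∃ z : B.PathSpace, AgreeFrom (n + 1) z x ∧ z.1 n = e := by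
  obtain ⟨y, hy⟩ := exists_path_vert (B.src n e)
  refine ⟨⟨Function.update (fun k => if k < n then y.1 k else x.1 k) n e, ?_⟩, ?_, ?_⟩
  · intro k
    rcases lt_trichotomy (k + 1) n with hk | hk | hk
    · have h1 : k < n := by omega
      rw [Function.update_of_ne hk.ne, Function.update_of_ne h1.ne]
      simp only [hk, h1, if_true]
      exact y.2 k
    · subst hk
      simp only [Function.update_self, ne_eq, k.lt_succ_self.ne, not_false_eq_true,
        Function.update_of_ne, k.lt_succ_self, if_true]
      exact (y.2 k).trans hy
    · rw [Function.update_of_ne hk.ne']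
      simp only [not_lt.2 hk.le, if_false]
      rcases eq_or_ne k n with h | h
      · subst h
        rw [Function.update_self]
        exact hx
      · have h1 : ¬ k < n := by omega
        rw [Function.update_of_ne h]
        simp only [h1, if_false]
        exact x.2 k
  · intro k hk
    have h1 : ¬ k < n := by omega
    have h2 : k ≠ n := by omega
    simp [h1, h2]
  · simp

end BratteliDiagram

/-! ### Positions and tower heights -/

namespace OrderedBratteliDiagram

open BratteliDiagram BratteliDiagram.PathSpace

variable {B : OrderedBratteliDiagram.{u}}

theorem PathLt.irrefl (x : B.PathSpace) : ¬ B.PathLt x x := fun ⟨_, h, _⟩ => B.lt_irrefl _ _ h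

theorem PathLt.trans {x y z : B.PathSpace} (h : B.PathLt x y) (h' : B.PathLt y z) :
    B.PathLt x z := by
  obtain ⟨i, hi, hi'⟩ := h
  obtain ⟨j, hj, hj'⟩ := h'
  rcases lt_trichotomy i j with hij | rfl | hij
  · exact ⟨j, by rwa [hi' j hij], fun k hk => (hi' k (hij.trans hk)).trans (hj' k hk)⟩
  · exact ⟨i, B.lt_trans _ _ _ _ hi hj, fun k hk => (hi' k hk).trans (hj' k hk)⟩
  · exact ⟨i, by rwa [← hj' i hij], fun k hk => (hi' k hk).trans (hj' k (hij.trans hk))⟩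

theorem PathLt.exists_agreeFrom {x y : B.PathSpace} (h : B.PathLt x y) :
    ∃ n, AgreeFrom n x y := by
  obtain ⟨i, -, hi⟩ := h
  exact ⟨i + 1, hi⟩

theorem PathLt.total {n : ℕ} {x y : B.PathSpace} (h : AgreeFrom n x y) :
    B.PathLt x y ∨ x = y ∨ B.PathLt y x := by
  induction n with
  | zero => exact Or.inr (Or.inl (PathSpace.ext fun k => h k k.zero_le))
  | succ n ih =>
    have hr : B.rng n (x.1 n) = B.rng n (y.1 n) := by
      rw [rng_eq_vert, rng_eq_vert, h.vert_eq le_rfl]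
    rcases B.lt_total n _ _ hr with h1 | h1 | h1
    · exact Or.inl ⟨n, h1, h⟩
    · refine ih fun k hk => ?_
      rcases hk.eq_or_lt with rfl | hk
      · exact h1
      · exact h k hk
    · exact Or.inr (Or.inr ⟨n, h1, h.symm⟩)

/-- Changing the tails of two comparable paths with a common tail does not change their order. -/
theorem PathLt.splice {n : ℕ} {z x x' : B.PathSpace} (h : B.PathLt z x) (hzx : AgreeFrom n z x)
    (hx : AgreeBelow n x' x) : B.PathLt (splice n z x') x' := by
  have hv : z.vert n = x'.vert n := (hzx.vert_eq le_rfl).trans (hx.vert_eq le_rfl).symm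
  obtain ⟨i, hi, hi'⟩ := h
  have hin : i < n := by
    by_contra hin
    rw [hzx i (not_lt.1 hin)] at hi
    exact B.lt_irrefl _ _ hi
  refine ⟨i, by rwa [splice_agreeBelow hv i hin, hx i hin], fun k hk => ?_⟩
  rcases Nat.lt_or_ge k n with hkn | hkn
  · rw [splice_agreeBelow hv k hkn, hx k hkn, hi' k hk]
  · exact splice_agreeFrom hv k hkn

variable (B) in
theorem finite_agreeFrom (n : ℕ) (x : B.PathSpace) :
    {z : B.PathSpace | AgreeFrom n z x}.Finite := by
  have := B.finite_E
  let f : {z : B.PathSpace | AgreeFrom n z x} → ∀ k : Fin n, B.E k := fun z k => z.1.1 k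
  refine Set.finite_coe_iff.1 (Finite.of_injective f fun z z' hzz => Subtype.ext ?_)
  exact eq_of_agree (n := n) (fun k hk => congrFun hzz ⟨k, hk⟩) (z.2.trans z'.2.symm)

/-- The number of finite paths from the root to the vertex `v`, computed as the number of paths
that share a fixed tail starting at `v`. -/
noncomputable def height (B : OrderedBratteliDiagram.{u}) (n : ℕ) (v : B.V n) : ℕ :=
  {z : B.PathSpace | AgreeFrom n z (exists_path_vert v).choose}.ncard

/-- The position of the first `n` edges of `x` in the list of all finite paths from the root to the
vertex of `x` at level `n`, computed as the number of paths that precede `x` and have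
the same tail from level `n` on. -/
noncomputable def pos (n : ℕ) (x : B.PathSpace) : ℕ :=
  {z : B.PathSpace | AgreeFrom n z x ∧ B.PathLt z x}.ncard

/-- Splicing is injective on the paths with a given tail. -/
theorem splice_injOn (n : ℕ) (x x' : B.PathSpace) (h : x.vert n = x'.vert n) :
    Set.InjOn (fun z => PathSpace.splice n z x') {z : B.PathSpace | AgreeFrom n z x} := by
  intro z hz z' hz' hzz
  have hv : z.vert n = x'.vert n := (AgreeFrom.vert_eq hz le_rfl).trans h
  have hv' : z'.vert n = x'.vert n := (AgreeFrom.vert_eq hz' le_rfl).trans h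
  refine eq_of_agree (n := n) ((splice_agreeBelow hv).symm.trans ?_) (AgreeFrom.trans hz hz'.symm)
  simp only at hzz
  rw [hzz]
  exact splice_agreeBelow hv'

/-- The number of paths with the tail of `x` from level `n` on depends only on the vertex where the
tail starts. -/
theorem height_vert (n : ℕ) (x : B.PathSpace) :
    B.height n (x.vert n) = {z : B.PathSpace | AgreeFrom n z x}.ncard := by
  have key : ∀ x x' : B.PathSpace, x.vert n = x'.vert n →
      {z : B.PathSpace | AgreeFrom n z x}.ncard ≤ {z : B.PathSpace | AgreeFrom n z x'}.ncard := by
    intro x x' h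
    refine Set.ncard_le_ncard_of_injOn _ (fun z hz => ?_) (splice_injOn n x x' h)
      (finite_agreeFrom B n x')
    exact splice_agreeFrom ((AgreeFrom.vert_eq hz le_rfl).trans h)
  have hx := (exists_path_vert (x.vert n)).choose_spec
  exact le_antisymm (key _ _ hx) (key _ _ hx.symm)

/-- The position depends only on the first `n` edges. -/
theorem pos_congr {n : ℕ} {x x' : B.PathSpace} (h : AgreeBelow n x x') : pos n x = pos n x' := by
  have key : ∀ x x' : B.PathSpace, AgreeBelow n x x' → pos n x ≤ pos n x' := by
    intro x x' h
    refine Set.ncard_le_ncard_of_injOn _ (fun z hz => ⟨?_, hz.2.splice hz.1 h.symm⟩)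
      ((splice_injOn n x x' (h.vert_eq le_rfl)).mono fun z hz => hz.1)
      ((finite_agreeFrom B n x').subset fun z hz => hz.1)
    exact splice_agreeFrom ((hz.1.vert_eq le_rfl).trans (h.vert_eq le_rfl))
  exact le_antisymm (key _ _ h) (key _ _ h.symm)

theorem pos_lt_height (n : ℕ) (x : B.PathSpace) : pos n x < B.height n (x.vert n) := by
  rw [height_vert]
  refine Set.ncard_lt_ncard ⟨fun z hz => hz.1, fun h => ?_⟩ (finite_agreeFrom B n x)
  exact PathLt.irrefl x (h (AgreeFrom.refl n x)).2

theorem height_pos {n : ℕ} (v : B.V n) : 0 < B.height n v := by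
  obtain ⟨x, rfl⟩ := exists_path_vert v
  exact (Nat.zero_le _).trans_lt (pos_lt_height n x)

theorem pos_lt_pos {n : ℕ} {x y : B.PathSpace} (h : AgreeFrom n x y) (hxy : B.PathLt x y) :
    pos n x < pos n y := by
  refine Set.ncard_lt_ncard ⟨fun z hz => ⟨hz.1.trans h, hz.2.trans hxy⟩, fun h' => ?_⟩
    ((finite_agreeFrom B n y).subset fun z hz => hz.1)
  exact PathLt.irrefl x (h' ⟨h, hxy⟩).2

theorem pathLt_iff_pos {n : ℕ} {x y : B.PathSpace} (h : AgreeFrom n x y) :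
    B.PathLt x y ↔ pos n x < pos n y := by
  refine ⟨pos_lt_pos h, fun hlt => ?_⟩
  rcases PathLt.total h with h1 | rfl | h1
  · exact h1
  · exact absurd hlt (Nat.lt_irrefl _)
  · exact absurd (pos_lt_pos h.symm h1) hlt.asymm

theorem eq_of_pos_eq {n : ℕ} {x y : B.PathSpace} (h : AgreeFrom n x y) (hp : pos n x = pos n y) :
    x = y := by
  rcases PathLt.total h with h1 | h1 | h1
  · exact absurd hp (pos_lt_pos h h1).ne
  · exact h1
  · exact absurd hp (pos_lt_pos h.symm h1).ne'

/-- The vertex at level `n` and the position determine the first `n` edges. -/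
theorem agreeBelow_of_pos_eq {n : ℕ} {x y : B.PathSpace} (hv : x.vert n = y.vert n)
    (hp : pos n x = pos n y) : AgreeBelow n x y := by
  have h1 := splice_agreeBelow hv
  rw [← eq_of_pos_eq (splice_agreeFrom hv) ((pos_congr h1).trans hp)]
  exact h1.symm

/-- Every number less than the height is the position of a path with the given tail, because
positions are distinct on the paths with this tail. -/
theorem exists_pos_eq {n : ℕ} (x : B.PathSpace) {j : ℕ} (hj : j < B.height n (x.vert n)) :
    ∃ z, AgreeFrom n z x ∧ pos n z = j := by
  rw [height_vert] at hj
  have himg : (pos n '' {z : B.PathSpace | AgreeFrom n z x}) =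
      Set.Iio {z : B.PathSpace | AgreeFrom n z x}.ncard := by
    refine Set.eq_of_subset_of_ncard_le ?_ ?_ (Set.finite_Iio _)
    · rintro _ ⟨z, hz, rfl⟩
      rw [Set.mem_Iio, ← height_vert, ← AgreeFrom.vert_eq hz le_rfl]
      exact pos_lt_height n z
    · have hinj : Set.InjOn (pos n) {z : B.PathSpace | AgreeFrom n z x} := fun z hz z' hz' h =>
        eq_of_pos_eq (AgreeFrom.trans hz (AgreeFrom.symm hz')) h
      rw [hinj.ncard_image]
      simp
  have : j ∈ pos n '' {z : B.PathSpace | AgreeFrom n z x} := himg ▸ hj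
  exact this

theorem isMinPath_iff {x : B.PathSpace} : B.IsMinPath x ↔ ∀ n, pos n x = 0 := by
  refine ⟨fun h n => ?_, fun h n e he => ?_⟩
  · have : {z : B.PathSpace | AgreeFrom n z x ∧ B.PathLt z x} = ∅ :=
      Set.eq_empty_iff_forall_notMem.2 fun z ⟨_, i, hi, _⟩ => h i _ hi
    rw [pos, this, Set.ncard_empty]
  · obtain ⟨z, hz, rfl⟩ := exists_path_edge e x ((B.rng_eq_of_lt _ _ _ he).trans (rng_eq_vert x n))
    have := pos_lt_pos hz ⟨n, he, hz⟩
    exact absurd (h (n + 1)) (Nat.ne_zero_of_lt this)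

theorem isMaxPath_iff {x : B.PathSpace} :
    B.IsMaxPath x ↔ ∀ n, pos n x + 1 = B.height n (x.vert n) := by
  refine ⟨fun h n => ?_, fun h n e he => ?_⟩
  · by_contra hne
    obtain ⟨z, hz, hpz⟩ := exists_pos_eq x (lt_of_le_of_ne (pos_lt_height n x) hne)
    obtain ⟨i, hi, -⟩ := (pathLt_iff_pos hz.symm).2 (by omega)
    exact h i _ hi
  · obtain ⟨z, hz, rfl⟩ := exists_path_edge e x
      ((B.rng_eq_of_lt _ _ _ he).symm.trans (rng_eq_vert x n))
    have h1 := pos_lt_pos hz.symm ⟨n, he, hz.symm⟩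
    have h2 := pos_lt_height (n + 1) z
    rw [hz.vert_eq le_rfl, ← h (n + 1)] at h2
    omega

/-- A path that is not maximal below level `m` is not maximal below any higher level. -/
theorem pos_add_one_lt_mono {m n : ℕ} (hmn : m ≤ n) {x : B.PathSpace}
    (h : pos m x + 1 < B.height m (x.vert m)) : pos n x + 1 < B.height n (x.vert n) := by
  obtain ⟨z, hz, hpz⟩ := exists_pos_eq x h
  have h1 := pos_lt_pos (hz.symm.mono hmn) ((pathLt_iff_pos hz.symm).2 (by omega))
  have h2 := pos_lt_height n z
  rw [(hz.mono hmn).vert_eq le_rfl] at h2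
  omega

/-- A path that is minimal below level `n` is minimal below any lower level. -/
theorem pos_eq_zero_mono {m n : ℕ} (hmn : m ≤ n) {x : B.PathSpace} (h : pos n x = 0) :
    pos m x = 0 := by
  by_contra hne
  obtain ⟨z, hz, hpz⟩ := exists_pos_eq x ((Nat.pos_of_ne_zero hne).trans (pos_lt_height m x))
  have h1 := pos_lt_pos (hz.mono hmn) ((pathLt_iff_pos hz).2 (by omega))
  omega

end OrderedBratteliDiagram

/-! ### Towers as words, and uniformly ordered levels -/

namespace OrderedBratteliDiagram

open BratteliDiagram BratteliDiagram.PathSpace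

variable {B : OrderedBratteliDiagram.{u}}

/-- For a word `v₁ ⋯ v_l` in the vertices at level `n`, the word `(v₁, 0) ⋯ (v₁, h₁ - 1) (v₂, 0) ⋯`,
where `hᵢ` is the number of paths from the root to `vᵢ`. It spells out the towers over the
vertices of the word. -/
noncomputable def towerWord (B : OrderedBratteliDiagram.{u}) (n : ℕ) (l : List (B.V n)) :
    List (B.V n × ℕ) :=
  l.flatMap fun v => (List.range (B.height n v)).map fun i => (v, i)

theorem towerWord_flatten (n : ℕ) (ls : List (List (B.V n))) :
    B.towerWord n ls.flatten = (ls.map (B.towerWord n)).flatten := by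
  induction ls with
  | nil => simp [towerWord]
  | cons l ls ih =>
    rw [List.flatten_cons, List.map_cons, List.flatten_cons, ← ih]
    simp [towerWord]

/-- The word can be recovered from its tower word by keeping the bottoms of the towers. -/
theorem filter_towerWord (n : ℕ) (l : List (B.V n)) :
    ((B.towerWord n l).filter fun a => a.2 = 0).map Prod.fst = l := by
  induction l with
  | nil => simp [towerWord]
  | cons v l ih =>
    have h1 : B.towerWord n (v :: l) =
        ((List.range (B.height n v)).map fun i => (v, i)) ++ B.towerWord n l := by
      simp [towerWord]
    obtain ⟨h, hh⟩ := Nat.exists_eq_succ_of_ne_zero (height_pos v).ne'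
    rw [h1, List.filter_append, List.map_append, ih, hh, List.range_succ_eq_map]
    simp [List.filter_map, Function.comp_def]

/-- If `p` divides all tower heights, then the position in the tower and the place in the tower word
are congruent modulo `p`. -/
theorem towerWord_mod {n p : ℕ} (hp : ∀ v, p ∣ B.height n v) (l : List (B.V n)) :
    p ∣ (B.towerWord n l).length ∧ (B.towerWord n l).map (fun a => a.2 % p) =
      (List.range (B.towerWord n l).length).map (· % p) := by
  induction l with
  | nil => simp [towerWord]
  | cons v l ih =>
    have h1 : B.towerWord n (v :: l) =
        ((List.range (B.height n v)).map fun i => (v, i)) ++ B.towerWord n l := by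
      simp [towerWord]
    obtain ⟨k, hk⟩ := hp v
    refine ⟨?_, ?_⟩
    · rw [h1, List.length_append, List.length_map, List.length_range]
      exact (hp v).add ih.1
    · rw [h1, List.map_append, ih.2, List.length_append, List.length_map, List.length_range,
        List.range_add, List.map_append, List.map_map, List.map_map, hk]
      simp [Function.comp_def]

/-- The list `L` of all paths with the tail of `x` from level `m` on, in increasing order, read at
level `n`: it runs through the towers over the sources of the paths `es` from level `n` to the
vertex of `x` at level `m`. -/
theorem exists_tower {n m : ℕ} (hnm : n < m) (x : B.PathSpace)
    {es : List (B.toBratteliDiagram.FinPath n m)} (hs : es.Pairwise B.FinPathLt)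
    (hmem : ∀ q, q ∈ es ↔ q.vert m hnm.le le_rfl = x.vert m) :
    ∃ L : List B.PathSpace, (∀ z, z ∈ L ↔ AgreeFrom m z x) ∧
      L.map (pos m) = List.range (B.height m (x.vert m)) ∧
      L.map (fun z => (z.vert n, pos n z)) =
        B.towerWord n (es.map fun q => q.vert n le_rfl hnm.le) := by
  have hex : ∀ (q : B.toBratteliDiagram.FinPath n m) (i : ℕ), ∃ z : B.PathSpace, q ∈ es →
      i < B.height n (q.vert n le_rfl hnm.le) → AgreeFrom m z x ∧ z.seg n m = q ∧ pos n z = i := by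
    intro q i
    by_cases h : q ∈ es ∧ i < B.height n (q.vert n le_rfl hnm.le)
    · obtain ⟨z, hz, hzq⟩ := exists_path_seg hnm q x ((hmem q).1 h.1)
      have hv : z.vert n = q.vert n le_rfl hnm.le := by rw [← hzq]; rfl
      obtain ⟨y, hy, hyi⟩ := exists_pos_eq z (hv.symm ▸ h.2)
      refine ⟨y, fun _ _ => ⟨(hy.mono hnm.le).trans hz, ?_, hyi⟩⟩
      rw [← hzq]
      exact FinPath.ext_edge hnm fun i h₁ _ => hy i h₁
    · exact ⟨x, fun h1 h2 => absurd ⟨h1, h2⟩ h⟩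
  -- `f q i` runs through `q` from level `n` to level `m` and has position `i` at level `n`
  choose f hf using hex
  have hfrom : ∀ z z' : B.PathSpace, AgreeFrom m z x → AgreeFrom m z' x →
      z.seg n m = z'.seg n m → AgreeFrom n z z' := by
    intro z z' h h' hs k hk
    rcases Nat.lt_or_ge k m with hkm | hkm
    · exact congrArg (fun q : B.toBratteliDiagram.FinPath n m => q.edge k hk hkm) hs
    · exact h.trans h'.symm k hkm
  let L := es.flatMap fun q =>
    (List.range (B.height n (q.vert n le_rfl hnm.le))).map (f q)
  have hL : ∀ z, z ∈ L ↔ AgreeFrom m z x := by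
    intro z
    simp only [L, List.mem_flatMap, List.mem_map, List.mem_range]
    constructor
    · rintro ⟨q, hq, i, hi, rfl⟩
      exact (hf q i hq hi).1
    · intro hz
      have hq : z.seg n m ∈ es := (hmem _).2 (hz.vert_eq le_rfl)
      refine ⟨z.seg n m, hq, pos n z, pos_lt_height n z, ?_⟩
      obtain ⟨h1, h2, h3⟩ := hf _ _ hq (pos_lt_height n z)
      exact eq_of_pos_eq (hfrom _ _ h1 hz h2) h3
  refine ⟨L, hL, ?_, ?_⟩
  · have hlt : L.Pairwise B.PathLt := by
      rw [List.pairwise_flatMap]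
      refine ⟨fun q hq => ?_, ?_⟩
      · rw [List.pairwise_map]
        refine List.pairwise_lt_range.imp_of_mem fun {i j} hi hj hij => ?_
        obtain ⟨h1, h2, h3⟩ := hf q i hq (List.mem_range.1 hi)
        obtain ⟨h1', h2', h3'⟩ := hf q j hq (List.mem_range.1 hj)
        rw [pathLt_iff_pos (hfrom _ _ h1 h1' (h2.trans h2'.symm)), h3, h3']
        exact hij
      · refine hs.imp_of_mem fun {q q'} hq hq' hqq' z hz z' hz' => ?_
        obtain ⟨i, hi, rfl⟩ := List.mem_map.1 hz
        obtain ⟨j, hj, rfl⟩ := List.mem_map.1 hz'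
        obtain ⟨h1, h2, -⟩ := hf q i hq (List.mem_range.1 hi)
        obtain ⟨h1', h2', -⟩ := hf q' j hq' (List.mem_range.1 hj)
        generalize f q i = z at h1 h2
        generalize f q' j = z' at h1' h2'
        -- the two paths have the same tail, so the comparison of their segments decides
        subst h2 h2'
        obtain ⟨k, hk, hk', hlt, heq⟩ := hqq'
        refine ⟨k, hlt, fun l hl => ?_⟩
        rcases Nat.lt_or_ge l m with hlm | hlm
        · exact heq l (hk.trans hl.le) hlm hl
        · exact h1.trans h1'.symm l hlm
    have hlt' : (L.map (pos m)).Pairwise (· < ·) := by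
      rw [List.pairwise_map]
      refine hlt.imp_of_mem fun {z z'} hz hz' h => ?_
      exact pos_lt_pos (((hL z).1 hz).trans ((hL z').1 hz').symm) h
    refine List.Pairwise.eq_of_mem_iff hlt' List.pairwise_lt_range fun {i} => ?_
    rw [List.mem_map, List.mem_range]
    constructor
    · rintro ⟨z, hz, rfl⟩
      rw [← ((hL z).1 hz).vert_eq le_rfl]
      exact pos_lt_height m z
    · intro hi
      obtain ⟨z, hz, hzi⟩ := exists_pos_eq x hi
      exact ⟨z, (hL z).2 hz, hzi⟩
  · simp only [L, towerWord, List.map_flatMap, List.flatMap_map, List.map_map]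
    refine List.flatMap_congr fun q hq => List.map_congr_left fun i hi => ?_
    obtain ⟨-, h2, h3⟩ := hf q i hq (List.mem_range.1 hi)
    have hv : (f q i).vert n = q.vert n le_rfl hnm.le :=
      congrArg (fun q : B.toBratteliDiagram.FinPath n m => q.vert n le_rfl hnm.le) h2
    rw [Function.comp_apply, h3, hv]

/-- The paths from level `n` to a given vertex at level `m` can be listed in increasing order: take
the paths with a fixed tail from level `m` on that are minimal below level `n`. -/
theorem exists_ordered_list {n m : ℕ} (hnm : n < m) (w : B.V m) :
    ∃ es : List (B.toBratteliDiagram.FinPath n m),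
      es.Pairwise B.FinPathLt ∧ ∀ q, q ∈ es ↔ q.vert m hnm.le le_rfl = w := by
  obtain ⟨x, rfl⟩ := exists_path_vert w
  have hex : ∀ i, ∃ z : B.PathSpace, i < B.height m (x.vert m) → AgreeFrom m z x ∧ pos m z = i := by
    intro i
    by_cases h : i < B.height m (x.vert m)
    · obtain ⟨z, hz⟩ := exists_pos_eq x h
      exact ⟨z, fun _ => hz⟩
    · exact ⟨x, fun h' => absurd h' h⟩
  choose z hz using hex
  refine ⟨((List.range (B.height m (x.vert m))).filter fun i => pos n (z i) = 0).map
    fun i => (z i).seg n m, ?_, fun q => ?_⟩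
  · rw [List.pairwise_map, List.pairwise_filter]
    refine List.pairwise_lt_range.imp_of_mem fun {i j} hi hj hij hi0 hj0 => ?_
    obtain ⟨h1, h2⟩ := hz i (List.mem_range.1 hi)
    obtain ⟨h1', h2'⟩ := hz j (List.mem_range.1 hj)
    have h3 := h1.trans h1'.symm
    obtain ⟨k, hk, hk'⟩ := (pathLt_iff_pos h3).2 (by omega)
    have hnk : n ≤ k := by
      by_contra hnk
      have h4 : AgreeFrom n (z i) (z j) := fun l hl => hk' l (by omega)
      have h5 := eq_of_pos_eq h4 (by simp_all)
      rw [h5] at hk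
      exact B.lt_irrefl _ _ hk
    have hkm : k < m := by
      by_contra hkm
      rw [h3 k (not_lt.1 hkm)] at hk
      exact B.lt_irrefl _ _ hk
    exact ⟨k, hnk, hkm, hk, fun l _ _ hl => hk' l hl⟩
  · simp only [List.mem_map, List.mem_filter, List.mem_range, decide_eq_true_eq]
    constructor
    · rintro ⟨i, ⟨hi, -⟩, rfl⟩
      exact (hz i hi).1.vert_eq le_rfl
    · intro hq
      obtain ⟨y, hy, rfl⟩ := exists_path_seg hnm q x hq
      obtain ⟨y', hy', hy0⟩ := exists_pos_eq y (height_pos (y.vert n))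
      have hyx := (hy'.mono hnm.le).trans hy
      have hlt : pos m y' < B.height m (x.vert m) := hyx.vert_eq le_rfl ▸ pos_lt_height m y'
      obtain ⟨h1, h2⟩ := hz _ hlt
      have h3 : z (pos m y') = y' := eq_of_pos_eq (h1.trans hyx.symm) h2
      refine ⟨pos m y', ⟨hlt, by rw [h3, hy0]⟩, ?_⟩
      rw [h3]
      exact FinPath.ext_edge hnm fun i h₁ _ => hy' i h₁

/-- The vertices at level `m` are uniformly ordered over those at level `n`: there is a word `v`
in the vertices at level `n` such that, for every vertex `w` at level `m`, the list of sources of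
the paths from level `n` to `w` is a power of `v`. -/
def IsUniformlyOrderedBetween (B : OrderedBratteliDiagram.{u}) {n m : ℕ} (hnm : n < m) : Prop :=
  ∃ v : List (B.V n), ∀ w : B.V m, ∃ (es : List (B.toBratteliDiagram.FinPath n m)) (k : ℕ),
    (es.Pairwise B.FinPathLt ∧ ∀ q, q ∈ es ↔ q.vert m hnm.le le_rfl = w) ∧
      es.map (fun q => q.vert n le_rfl hnm.le) = (List.replicate k v).flatten

theorem isUniformlyOrderedLevel_telescope_iff {φ : ℕ → ℕ} (hφ : StrictMono φ) (h0 : φ 0 = 0)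
    (n : ℕ) : (B.telescope φ hφ h0).IsUniformlyOrderedLevel n ↔
      B.IsUniformlyOrderedBetween (hφ n.lt_succ_self) := Iff.rfl

theorem flatten_replicate_map_range {α : Type*} (F : ℕ → α) (p k : ℕ) :
    (List.replicate k ((List.range p).map F)).flatten =
      (List.range (k * p)).map fun i => F (i % p) := by
  induction k with
  | zero => simp
  | succ k ih =>
    rw [List.replicate_succ', List.flatten_append, ih, Nat.succ_mul, List.range_add,
      List.map_append, List.map_map]
    congr 1
    simp only [List.flatten_cons, List.flatten_nil, List.append_nil]
    refine List.map_congr_left fun i hi => ?_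
    simp [Nat.mod_eq_of_lt (List.mem_range.1 hi)]

/-- If the number of paths from the root to any vertex at level `n` is a multiple of `p`, then the
same is true at every higher level, and positions modulo `p` do not depend on the level. -/
theorem pos_mod_eq {n m p : ℕ} (hnm : n ≤ m) (hp : ∀ v, p ∣ B.height n v) (x : B.PathSpace) :
    p ∣ B.height m (x.vert m) ∧ pos m x % p = pos n x % p := by
  rcases hnm.eq_or_lt with rfl | hnm
  · exact ⟨hp _, rfl⟩
  obtain ⟨es, hs, hmem⟩ := exists_ordered_list hnm (x.vert m)
  obtain ⟨L, hL, hpos, htower⟩ := exists_tower hnm x hs hmem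
  obtain ⟨h1, h2⟩ := towerWord_mod hp (es.map fun q => q.vert n le_rfl hnm.le)
  have hlen : L.length = B.height m (x.vert m) := by
    rw [← List.length_map (pos m), hpos, List.length_range]
  rw [← htower, List.length_map, hlen] at h1 h2
  rw [← hpos, List.map_map, List.map_map] at h2
  exact ⟨h1, (List.map_inj_left.1 h2 x ((hL x).2 (AgreeFrom.refl m x))).symm⟩

/-- In the uniformly ordered case, the position at level `m` modulo the length `p` of the common
period of all towers determines the path below level `n`. -/
theorem IsUniformlyOrderedBetween.exists_period {n m : ℕ} {hnm : n < m} [Nonempty B.PathSpace]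
    (h : B.IsUniformlyOrderedBetween hnm) :
    ∃ p, 0 < p ∧ (∀ w, p ∣ B.height m w) ∧ (∀ q, (∀ v, q ∣ B.height n v) → q ∣ p) ∧
      ∀ x y : B.PathSpace, pos m x % p = pos m y % p → AgreeBelow n x y := by
  obtain ⟨v, hv⟩ := h
  obtain ⟨x₀⟩ := ‹Nonempty B.PathSpace›
  let p := (B.towerWord n v).length
  -- the default value of `getD` is irrelevant: only indices below `p` are used
  let F : ℕ → B.V n × ℕ := fun i => (B.towerWord n v).getD i (x₀.vert n, 0)
  have hF : B.towerWord n v = (List.range p).map F := by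
    refine List.ext_getElem (by simp [p]) fun i h1 h2 => ?_
    simp [F, h1]
  have key : ∀ x : B.PathSpace, p ∣ B.height m (x.vert m) ∧
      F (pos m x % p) = (x.vert n, pos n x) := by
    intro x
    obtain ⟨es, k, ⟨hs, hmem⟩, hk⟩ := hv (x.vert m)
    obtain ⟨L, hL, hpos, htower⟩ := exists_tower hnm x hs hmem
    rw [hk, towerWord_flatten, List.map_replicate, hF, flatten_replicate_map_range] at htower
    have hlen : B.height m (x.vert m) = k * p := by
      rw [← List.length_range (n := B.height m (x.vert m)), ← hpos, List.length_map,
        ← List.length_map (fun z : B.PathSpace => (z.vert n, pos n z)), htower, List.length_map,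
        List.length_range]
    rw [← hlen, ← hpos, List.map_map] at htower
    exact ⟨hlen ▸ Dvd.intro_left k rfl,
      (List.map_inj_left.1 htower x ((hL x).2 (AgreeFrom.refl m x))).symm⟩
  refine ⟨p, ?_, fun w => ?_, fun q hq => (towerWord_mod hq v).1, fun x y hxy => ?_⟩
  · exact Nat.pos_of_dvd_of_pos (key x₀).1 (height_pos _)
  · obtain ⟨x, rfl⟩ := exists_path_vert w
    exact (key x).1
  · have h1 := (key x).2.symm.trans ((congrArg F hxy).trans (key y).2)
    exact agreeBelow_of_pos_eq (congrArg Prod.fst h1) (congrArg Prod.snd h1)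

/-- If the position at level `m` modulo a common divisor `p` of the tower heights determines the
path below level `n`, then level `m` is uniformly ordered over level `n`. -/
theorem isUniformlyOrderedBetween_of_period {n m p : ℕ} (hnm : n < m) [Nonempty B.PathSpace]
    (hp : ∀ w, p ∣ B.height m w)
    (h : ∀ x y : B.PathSpace, pos m x % p = pos m y % p → AgreeBelow n x y) :
    B.IsUniformlyOrderedBetween hnm := by
  classical
  obtain ⟨x₀⟩ := ‹Nonempty B.PathSpace›
  let G : B.PathSpace → B.V n × ℕ := fun x => (x.vert n, pos n x)
  let F : ℕ → B.V n × ℕ := fun i => if hi : ∃ x : B.PathSpace, pos m x % p = i then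
    G hi.choose else G x₀
  have hFG : ∀ x, F (pos m x % p) = G x := by
    intro x
    have hi : ∃ y : B.PathSpace, pos m y % p = pos m x % p := ⟨x, rfl⟩
    have h1 := h _ _ hi.choose_spec
    simp only [F, hi, dif_pos, G]
    rw [h1.vert_eq le_rfl, pos_congr h1]
  -- the period of the tower words, of which only the bottoms of the towers are kept
  refine ⟨(((List.range p).map F).filter fun a => a.2 = 0).map Prod.fst, fun w => ?_⟩
  obtain ⟨x, rfl⟩ := exists_path_vert w
  obtain ⟨es, hs, hmem⟩ := exists_ordered_list hnm (x.vert m)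
  obtain ⟨L, hL, hpos, htower⟩ := exists_tower hnm x hs hmem
  obtain ⟨k, hk⟩ := hp (x.vert m)
  refine ⟨es, k, ⟨hs, hmem⟩, ?_⟩
  rw [← filter_towerWord n (es.map _), ← htower]
  have h1 : L.map G = (List.replicate k ((List.range p).map F)).flatten := by
    rw [flatten_replicate_map_range, Nat.mul_comm, ← hk, ← hpos, List.map_map]
    exact List.map_congr_left fun z _ => (hFG z).symm
  change ((L.map G).filter _).map _ = _
  rw [h1, List.filter_flatten, List.map_flatten, List.map_replicate, List.map_replicate]

end OrderedBratteliDiagram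

/-! ### Topology of the path space and the adic homeomorphism -/

namespace BratteliDiagram

open PathSpace Topology

variable {B : BratteliDiagram.{u}}

instance : T2Space B.PathSpace :=
  let _ : ∀ n, TopologicalSpace (B.E n) := fun _ => ⊥
  have : ∀ n, DiscreteTopology (B.E n) := fun _ => ⟨rfl⟩
  inferInstanceAs
    (T2Space {x : ∀ n, B.E n // ∀ n, B.rng n (x n) = B.src (n + 1) (x (n + 1))})

namespace PathSpace

theorem isOpen_agreeBelow (n : ℕ) (x : B.PathSpace) : IsOpen {y | AgreeBelow n y x} := by
  let _ : ∀ n, TopologicalSpace (B.E n) := fun _ => ⊥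
  have : ∀ n, DiscreteTopology (B.E n) := fun _ => ⟨rfl⟩
  have h1 : {y : B.PathSpace | AgreeBelow n y x} =
      ⋂ k ∈ Set.Iio n, {y : B.PathSpace | y.1 k = x.1 k} := by
    ext y
    simp [AgreeBelow]
  rw [h1]
  refine (Set.finite_Iio n).isOpen_biInter fun k _ => ?_
  have hc : Continuous fun y : B.PathSpace => y.1 k :=
    (continuous_apply k).comp continuous_subtype_val
  exact (isOpen_discrete {x.1 k}).preimage hc

theorem exists_agreeBelow_subset {x : B.PathSpace} {U : Set B.PathSpace} (hU : U ∈ 𝓝 x) :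
    ∃ n, ∀ y, AgreeBelow n y x → y ∈ U := by
  let _ : ∀ n, TopologicalSpace (B.E n) := fun _ => ⊥
  have : ∀ n, DiscreteTopology (B.E n) := fun _ => ⟨rfl⟩
  obtain ⟨O, hOU, hO, hx⟩ := mem_nhds_iff.1 hU
  obtain ⟨V, hV, rfl⟩ := isOpen_induced_iff.1 hO
  have hV' := hV.mem_nhds hx
  rw [nhds_pi, Filter.mem_pi'] at hV'
  obtain ⟨I, t, ht, htV⟩ := hV'
  refine ⟨I.sup id + 1, fun y hy => hOU (htV fun k hk => ?_)⟩
  rw [hy k (Nat.lt_succ_of_le (Finset.le_sup (f := id) hk))]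
  exact mem_of_mem_nhds (ht k)

theorem agreeBelow_mem_nhds (n : ℕ) (x : B.PathSpace) : {y | AgreeBelow n y x} ∈ 𝓝 x :=
  (isOpen_agreeBelow n x).mem_nhds fun _ _ => rfl

theorem continuous_iff {Y : Type*} [TopologicalSpace Y] {f : Y → B.PathSpace} :
    Continuous f ↔ ∀ n y, ∀ᶠ z in 𝓝 y, AgreeBelow n (f z) (f y) := by
  refine ⟨fun h n y => h.continuousAt (agreeBelow_mem_nhds n (f y)), fun h => ?_⟩
  refine continuous_iff_continuousAt.2 fun y U hU => ?_
  obtain ⟨n, hn⟩ := exists_agreeBelow_subset hU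
  exact Filter.mem_of_superset (h n y) fun z hz => hn _ hz

/-- On a compact path space, a locally constant function depends on finitely many edges only. The
function enters through the relation `R` of having the same value. -/
theorem exists_agreeBelow_imp_eq [CompactSpace B.PathSpace] {R : B.PathSpace → B.PathSpace → Prop}
    (hsymm : ∀ x y, R x y → R y x) (htrans : ∀ x y z, R x y → R y z → R x z)
    (h : ∀ x, ∀ᶠ y in 𝓝 x, R y x) : ∃ n, ∀ x y, AgreeBelow n x y → R x y := by
  have h' : ∀ x, ∃ n, ∀ y, AgreeBelow n y x → R y x := fun x => exists_agreeBelow_subset (h x)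
  choose n hn using h'
  obtain ⟨t, -, ht⟩ := isCompact_univ.elim_nhds_subcover
    (fun x => {y : B.PathSpace | AgreeBelow (n x) y x}) fun x _ => agreeBelow_mem_nhds (n x) x
  refine ⟨t.sup n, fun x y hxy => ?_⟩
  obtain ⟨z, hz, hxz⟩ := Set.mem_iUnion₂.1 (ht (Set.mem_univ x))
  have h1 := hxy.mono (Finset.le_sup (f := n) hz)
  exact htrans _ _ _ (hn z x hxz) (hsymm _ _ (hn z y (h1.symm.trans hxz)))

theorem isClosed_of_agreeBelow {Z : Set B.PathSpace} (n : ℕ)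
    (h : ∀ x y, AgreeBelow n x y → x ∈ Z → y ∈ Z) : IsClosed Z := by
  refine ⟨isOpen_iff_mem_nhds.2 fun y hy => ?_⟩
  exact Filter.mem_of_superset (agreeBelow_mem_nhds n y) fun z hz hzZ => hy (h z y hz hzZ)

/-- If a decreasing sequence of closed sets intersects in at most the point `x`, then the sets are
eventually contained in any given cylinder around `x`. -/
theorem exists_forall_agreeBelow [CompactSpace B.PathSpace] {Z : ℕ → Set B.PathSpace}
    (hZ : Antitone Z) (hcl : ∀ n, IsClosed (Z n)) {x : B.PathSpace}
    (hx : ∀ y, (∀ n, y ∈ Z n) → y = x) (n : ℕ) : ∃ m₀, ∀ m, m₀ ≤ m → ∀ y ∈ Z m,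
      AgreeBelow n y x := by
  obtain ⟨m, hm⟩ := exists_subset_nhds_of_isCompact (V := Z)
    (directed_of_isDirected_le fun i j hij => hZ hij) (fun i => (hcl i).isCompact)
    (U := {y | AgreeBelow n y x}) fun y hy => by
      rw [hx y (Set.mem_iInter.1 hy)]
      exact agreeBelow_mem_nhds n x
  exact ⟨m, fun m' hm' y hy => hm (hZ hm' hy)⟩

theorem exists_mem_of_antitone [CompactSpace B.PathSpace] {Z : ℕ → Set B.PathSpace}
    (hZ : Antitone Z) (hcl : ∀ n, IsClosed (Z n)) (hne : ∀ n, (Z n).Nonempty) :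
    ∃ x, ∀ n, x ∈ Z n := by
  obtain ⟨x, hx⟩ := IsCompact.nonempty_iInter_of_sequence_nonempty_isCompact_isClosed Z
    (fun i => hZ i.le_succ) hne (hcl 0).isCompact hcl
  exact ⟨x, Set.mem_iInter.1 hx⟩

end PathSpace

end BratteliDiagram

namespace OrderedBratteliDiagram

open BratteliDiagram BratteliDiagram.PathSpace Topology

variable {B : OrderedBratteliDiagram.{u}}

/-- A path between two paths with a common tail has the same tail. -/
theorem PathLt.agreeFrom_of_between {n : ℕ} {x y z : B.PathSpace} (hxy : B.PathLt x y)
    (hyz : B.PathLt y z) (hxz : AgreeFrom n x z) : AgreeFrom n x y := by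
  obtain ⟨i, hi, hi'⟩ := hxy
  rcases Nat.lt_or_ge i n with hin | hin
  · exact fun k hk => hi' k (hin.trans_le hk)
  exfalso
  obtain ⟨j, hj, hj'⟩ := hyz
  rcases lt_trichotomy i j with hij | rfl | hij
  · rw [← hxz j (hin.trans hij.le), hi' j hij] at hj
    exact B.lt_irrefl _ _ hj
  · rw [← hxz i hin] at hj
    exact B.lt_irrefl _ _ (B.lt_trans _ _ _ _ hi hj)
  · rw [hxz i hin, hj' i hij] at hi
    exact B.lt_irrefl _ _ hi

theorem antitone_pos_eq_zero : Antitone fun n => {x : B.PathSpace | pos n x = 0} :=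
  fun _ _ hmn _ hx => pos_eq_zero_mono hmn hx

theorem antitone_pos_eq_top :
    Antitone fun n => {x : B.PathSpace | pos n x + 1 = B.height n (x.vert n)} := by
  intro m n hmn x hx
  by_contra hne
  exact (pos_add_one_lt_mono hmn (lt_of_le_of_ne (pos_lt_height m x) hne)).ne hx

theorem isClosed_pos_eq (n j : ℕ) : IsClosed {x : B.PathSpace | pos n x = j} :=
  isClosed_of_agreeBelow n fun _ _ h hx => (pos_congr h).symm.trans hx

theorem pos_eq_top_congr {n : ℕ} {x y : B.PathSpace} (h : AgreeBelow n x y)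
    (hx : pos n x + 1 = B.height n (x.vert n)) : pos n y + 1 = B.height n (y.vert n) := by
  rw [← pos_congr h, ← h.vert_eq le_rfl, hx]

theorem isClosed_pos_eq_top (n : ℕ) :
    IsClosed {x : B.PathSpace | pos n x + 1 = B.height n (x.vert n)} :=
  isClosed_of_agreeBelow n fun _ _ h hx => pos_eq_top_congr h hx

theorem exists_isMinPath [CompactSpace B.PathSpace] [Nonempty B.PathSpace] :
    ∃ x, B.IsMinPath x := by
  obtain ⟨x₀⟩ := ‹Nonempty B.PathSpace›
  obtain ⟨x, hx⟩ := exists_mem_of_antitone (antitone_pos_eq_zero (B := B))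
    (fun n => isClosed_pos_eq n 0) fun n => by
      obtain ⟨z, -, hz⟩ := exists_pos_eq x₀ (height_pos (x₀.vert n))
      exact ⟨z, hz⟩
  exact ⟨x, isMinPath_iff.2 hx⟩

theorem exists_isMaxPath [CompactSpace B.PathSpace] [Nonempty B.PathSpace] :
    ∃ x, B.IsMaxPath x := by
  obtain ⟨x₀⟩ := ‹Nonempty B.PathSpace›
  obtain ⟨x, hx⟩ := exists_mem_of_antitone (antitone_pos_eq_top (B := B))
    isClosed_pos_eq_top fun n => by
      obtain ⟨z, hz, hz'⟩ := exists_pos_eq x₀ (Nat.sub_lt (height_pos (x₀.vert n)) one_pos)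
      refine ⟨z, ?_⟩
      have := height_pos (z.vert n)
      rw [← hz.vert_eq le_rfl] at hz'
      simp only [Set.mem_ofPred_eq]
      omega
  exact ⟨x, isMaxPath_iff.2 hx⟩

/-- The map `T` satisfies the order conditions in the definition of the adic homeomorphism. -/
def IsAdicMap (B : OrderedBratteliDiagram.{u}) (T : B.PathSpace → B.PathSpace) : Prop :=
  (∀ x, ¬ B.IsMaxPath x →
    B.PathLt x (T x) ∧ ∀ y, B.PathLt x y → y = T x ∨ B.PathLt (T x) y) ∧
  ∀ x, B.IsMaxPath x → B.IsMinPath (T x)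

/-- Below the top of the tower, the adic map moves up by one floor. -/
theorem IsAdicMap.of_lt {T : B.PathSpace → B.PathSpace} (hT : B.IsAdicMap T) {n : ℕ}
    {x : B.PathSpace} (hx : pos n x + 1 < B.height n (x.vert n)) :
    AgreeFrom n (T x) x ∧ pos n (T x) = pos n x + 1 := by
  obtain ⟨y, hy, hyx⟩ := exists_pos_eq x hx
  have hmax : ¬ B.IsMaxPath x := fun h => hx.ne (isMaxPath_iff.1 h n)
  obtain ⟨h1, h2⟩ := hT.1 x hmax
  rcases h2 y ((pathLt_iff_pos hy.symm).2 (by omega)) with rfl | h3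
  · exact ⟨hy, hyx⟩
  · exfalso
    have hfrom := (h1.agreeFrom_of_between h3 hy.symm).symm
    have h4 := pos_lt_pos hfrom.symm h1
    have h5 := pos_lt_pos (hfrom.trans hy.symm) h3
    omega

/-- The adic map sends the top of each tower to the bottom of a tower. -/
theorem IsAdicMap.of_eq {T : B.PathSpace → B.PathSpace} (hT : B.IsAdicMap T) {n : ℕ}
    {x : B.PathSpace} (hx : pos n x + 1 = B.height n (x.vert n)) : pos n (T x) = 0 := by
  by_cases hmax : B.IsMaxPath x
  · exact isMinPath_iff.1 (hT.2 x hmax) n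
  obtain ⟨⟨i, hi, hi'⟩, h2⟩ := hT.1 x hmax
  by_contra hne
  obtain ⟨y, hy, hy0⟩ := exists_pos_eq (T x) (height_pos ((T x).vert n))
  have hlt : B.PathLt y (T x) := (pathLt_iff_pos hy).2 (by omega)
  have hin : n ≤ i := by
    by_contra hin
    have hfrom : AgreeFrom n x (T x) := fun k hk => hi' k (by omega)
    have h3 := pos_lt_pos hfrom ⟨i, hi, hi'⟩
    have h4 := pos_lt_height n (T x)
    rw [← hfrom.vert_eq le_rfl] at h4
    omega
  -- replacing the part of `T x` below level `n` by the minimal one keeps the path larger than `x`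
  rcases h2 y ⟨i, by rwa [hy i hin], fun k hk => by rw [hy k (by omega), hi' k hk]⟩ with h3 | h3
  · rw [h3] at hlt
    exact PathLt.irrefl _ hlt
  · exact PathLt.irrefl _ (hlt.trans h3)

/-- If all towers at level `n` have a height divisible by `p`, then the adic map adds `1` to the
position modulo `p`. -/
theorem IsAdicMap.pos_modEq {T : B.PathSpace → B.PathSpace} (hT : B.IsAdicMap T) {n p : ℕ}
    (hp : ∀ v, p ∣ B.height n v) (x : B.PathSpace) : pos n (T x) ≡ pos n x + 1 [MOD p] := by
  rcases (Nat.succ_le_of_lt (pos_lt_height n x)).lt_or_eq with h | h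
  · rw [(hT.of_lt h).2]
  · rw [hT.of_eq h]
    refine ((Nat.modEq_zero_iff_dvd).2 ?_).symm
    rw [← Nat.succ_eq_add_one, h]
    exact hp _

theorem exists_pos_add_one_lt {x : B.PathSpace} (hx : ¬ B.IsMaxPath x) :
    ∃ n, pos n x + 1 < B.height n (x.vert n) := by
  by_contra! h
  exact hx (isMaxPath_iff.2 fun n => le_antisymm (pos_lt_height n x) (h n))

theorem exists_successor {x : B.PathSpace} (hx : ¬ B.IsMaxPath x) :
    ∃ z, B.PathLt x z ∧ ∀ y, B.PathLt x y → y = z ∨ B.PathLt z y := by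
  obtain ⟨n, hn⟩ := exists_pos_add_one_lt hx
  obtain ⟨z, hz, hzx⟩ := exists_pos_eq x hn
  have hxz : B.PathLt x z := (pathLt_iff_pos hz.symm).2 (by omega)
  refine ⟨z, hxz, fun y hy => ?_⟩
  obtain ⟨k, hk⟩ := hy.exists_agreeFrom
  have hyx : AgreeFrom (max n k) y x := hk.symm.mono (le_max_right _ _)
  rcases PathLt.total (hyx.trans (hz.symm.mono (le_max_left _ _))) with h | h | h
  · exfalso
    have hxy := hy.agreeFrom_of_between h hz.symm
    have h1 := pos_lt_pos hxy hy
    have h2 := pos_lt_pos (hxy.symm.trans hz.symm) h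
    omega
  · exact Or.inl h
  · exact Or.inr h

theorem exists_isAdicMap (h : ∃ x, B.IsMinPath x) : ∃ T, B.IsAdicMap T := by
  classical
  obtain ⟨x₀, hx₀⟩ := h
  have hT : ∀ x, ∃ z, (¬ B.IsMaxPath x →
      B.PathLt x z ∧ ∀ y, B.PathLt x y → y = z ∨ B.PathLt z y) ∧
      (B.IsMaxPath x → B.IsMinPath z) := by
    intro x
    by_cases hx : B.IsMaxPath x
    · exact ⟨x₀, fun h => absurd hx h, fun _ => hx₀⟩
    · obtain ⟨z, hz⟩ := exists_successor hx
      exact ⟨z, fun _ => hz, fun h => absurd h hx⟩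
  choose T hT using hT
  exact ⟨T, fun x => (hT x).1, fun x => (hT x).2⟩

theorem IsAdicMap.injective {T : B.PathSpace → B.PathSpace} (hT : B.IsAdicMap T)
    (hmax : ∃! x, B.IsMaxPath x) : Function.Injective T := by
  have hne : ∀ x y, ¬ B.IsMaxPath x → B.IsMaxPath y → T x ≠ T y := by
    intro x y hx hy hxy
    obtain ⟨n, hn⟩ := exists_pos_add_one_lt hx
    have h1 := (hT.of_lt hn).2
    rw [hxy, isMinPath_iff.1 (hT.2 y hy) n] at h1
    omega
  intro x y hxy
  by_cases hx : B.IsMaxPath x <;> by_cases hy : B.IsMaxPath y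
  · exact hmax.unique hx hy
  · exact absurd hxy.symm (hne y x hy hx)
  · exact absurd hxy (hne x y hx hy)
  · obtain ⟨n, hn⟩ := exists_pos_add_one_lt hx
    obtain ⟨k, hk⟩ := exists_pos_add_one_lt hy
    obtain ⟨h1, h2⟩ := hT.of_lt (pos_add_one_lt_mono (le_max_left n k) hn)
    obtain ⟨h3, h4⟩ := hT.of_lt (pos_add_one_lt_mono (le_max_right n k) hk)
    rw [hxy] at h1 h2
    exact eq_of_pos_eq (h1.symm.trans h3) (by omega)

theorem IsAdicMap.surjective {T : B.PathSpace → B.PathSpace} (hT : B.IsAdicMap T)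
    (hmax : ∃ x, B.IsMaxPath x) (hmin : ∃! x, B.IsMinPath x) : Function.Surjective T := by
  intro z
  by_cases hz : B.IsMinPath z
  · obtain ⟨x, hx⟩ := hmax
    exact ⟨x, hmin.unique (hT.2 x hx) hz⟩
  · rw [isMinPath_iff] at hz
    push Not at hz
    obtain ⟨n, hn⟩ := hz
    have h1 := pos_lt_height n z
    obtain ⟨x, hx, hxz⟩ := exists_pos_eq (n := n) z (j := pos n z - 1) (by omega)
    obtain ⟨h2, h3⟩ := hT.of_lt (n := n) (x := x) (by rw [hx.vert_eq le_rfl]; omega)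
    exact ⟨x, eq_of_pos_eq (h2.trans hx) (by omega)⟩

theorem IsAdicMap.continuous [CompactSpace B.PathSpace] {T : B.PathSpace → B.PathSpace}
    (hT : B.IsAdicMap T) (hmin : ∃! x, B.IsMinPath x) : Continuous T := by
  refine PathSpace.continuous_iff.2 fun n x => ?_
  by_cases hx : B.IsMaxPath x
  -- near the maximal path, the images are minimal below a high level, hence near the minimal path
  · obtain ⟨m, hm⟩ := exists_forall_agreeBelow (antitone_pos_eq_zero (B := B))
      (fun n => isClosed_pos_eq n 0) (x := T x)
      (fun y hy => hmin.unique (isMinPath_iff.2 hy) (hT.2 x hx)) n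
    filter_upwards [agreeBelow_mem_nhds m x] with y hy
    exact hm m le_rfl _ (hT.of_eq (pos_eq_top_congr hy.symm (isMaxPath_iff.1 hx m)))
  · obtain ⟨m, hm⟩ := exists_pos_add_one_lt hx
    have hm' := pos_add_one_lt_mono (le_max_left m n) hm
    filter_upwards [agreeBelow_mem_nhds (max m n) x] with y hy
    have hy' := hm'
    rw [← pos_congr hy, ← hy.vert_eq le_rfl] at hy'
    obtain ⟨h1, h2⟩ := hT.of_lt hm'
    obtain ⟨h3, h4⟩ := hT.of_lt hy'
    refine (agreeBelow_of_pos_eq ?_ ?_).mono (le_max_right m n)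
    · rw [h3.vert_eq le_rfl, h1.vert_eq le_rfl, hy.vert_eq le_rfl]
    · rw [h4, h2, pos_congr hy]

/-- The adic homeomorphism of a properly ordered diagram exists. -/
theorem IsProperlyOrdered.exists_isAdicHomeomorph [CompactSpace B.PathSpace]
    (h : B.IsProperlyOrdered) : ∃ T, B.IsAdicHomeomorph T := by
  obtain ⟨T, hT⟩ := exists_isAdicMap h.2.exists
  exact ⟨(hT.continuous h.2).homeoOfEquivCompactToT2
    (f := Equiv.ofBijective T ⟨hT.injective h.1, hT.surjective h.1.exists h.2⟩), hT⟩

end OrderedBratteliDiagram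

/-! ### From an odometer to uniformly ordered levels, and residues of positions -/

namespace OrderedBratteliDiagram

open BratteliDiagram BratteliDiagram.PathSpace Topology

variable {B : OrderedBratteliDiagram.{u}}

/-- If the adic system is conjugate to an odometer, then over each level some higher level is
uniformly ordered. -/
theorem exists_isUniformlyOrderedBetween {C : OrderedBratteliDiagram.{u}}
    [CompactSpace B.PathSpace] [CompactSpace C.PathSpace] (hB : B.IsProperlyOrdered)
    (hC : ∀ n, Nat.card (C.V n) = 1) (hBC : B.AdicConjugate C) (n : ℕ) :
    ∃ m, ∃ hnm : n < m, B.IsUniformlyOrderedBetween hnm := by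
  obtain ⟨T, S, h, hT, hS, hTS⟩ := hBC
  obtain ⟨xmax, hmax, hmax'⟩ := hB.1
  obtain ⟨xmin, hmin, hmin'⟩ := hB.2
  replace hT : B.IsAdicMap T := hT
  replace hS : C.IsAdicMap S := hS
  have hsub : ∀ n, Subsingleton (C.V n) := fun n => (Nat.card_eq_one_iff_unique.1 (hC n)).1
  -- the first `j` edges of `h x` determine the first `n` edges of `x`
  obtain ⟨j, hj⟩ := exists_agreeBelow_imp_eq (B := C.toBratteliDiagram)
    (R := fun y y' => AgreeBelow n (h.symm y) (h.symm y')) (fun _ _ h => h.symm)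
    (fun _ _ _ h h' => h.trans h') fun y => PathSpace.continuous_iff.1 h.symm.continuous n y
  -- the first `l` edges of `x` determine the first `j` edges of `h x`
  obtain ⟨l, hl⟩ := exists_agreeBelow_imp_eq (B := B.toBratteliDiagram)
    (R := fun x x' => AgreeBelow j (h x) (h x')) (fun _ _ h => h.symm)
    (fun _ _ _ h h' => h.trans h') fun x => PathSpace.continuous_iff.1 h.continuous j x
  let q := C.height j ((h xmin).vert j)
  let g : B.PathSpace → ℕ := fun x => pos j (h x)
  have hq : ∀ v, C.height j v = q := fun v => congrArg (C.height j) (Subsingleton.elim _ _)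
  have hgq : ∀ x, g x < q := fun x => hq _ ▸ pos_lt_height j (h x)
  have hg : ∀ x y, AgreeBelow l x y → g x = g y := fun x y hxy => pos_congr (hl x y hxy)
  have hgn : ∀ x y, g x = g y → AgreeBelow n x y := by
    intro x y hxy
    have h1 := hj _ _ (agreeBelow_of_pos_eq (Subsingleton.elim _ _) hxy)
    simpa using h1
  have hgT : ∀ x, g (T x) ≡ g x + 1 [MOD q] := by
    intro x
    simp only [g, hTS]
    exact hS.pos_modEq (fun v => (hq v).symm.dvd) (h x)
  -- for large `m`, paths that are extremal below level `m` share `l` edges with the extremal path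
  obtain ⟨m₁, hm₁⟩ := exists_forall_agreeBelow (antitone_pos_eq_zero (B := B))
    (fun n => isClosed_pos_eq n 0) (fun y hy => hmin' y (isMinPath_iff.2 hy)) l
  obtain ⟨m₂, hm₂⟩ := exists_forall_agreeBelow (antitone_pos_eq_top (B := B))
    isClosed_pos_eq_top (fun y hy => hmax' y (isMaxPath_iff.2 hy)) l
  let m := max (n + 1) (max m₁ m₂)
  have hnm : n < m := Nat.lt_of_succ_le (le_max_left _ _)
  have hm0 : ∀ x : B.PathSpace, pos m x = 0 → g x = g xmin := fun x hx =>
    hg _ _ (hm₁ m ((le_max_left _ _).trans (le_max_right _ _)) x hx)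
  have hm1 : ∀ x : B.PathSpace, pos m x + 1 = B.height m (x.vert m) → g x = g xmax := fun x hx =>
    hg _ _ (hm₂ m ((le_max_right _ _).trans (le_max_right _ _)) x hx)
  have key : ∀ i, ∀ x : B.PathSpace, pos m x = i → g x ≡ g xmin + i [MOD q] := by
    intro i
    induction i with
    | zero => exact fun x hx => by rw [hm0 x hx, add_zero]
    | succ i ih =>
      intro x hx
      have h1 := pos_lt_height m x
      obtain ⟨y, hy, hyi⟩ := exists_pos_eq (n := m) x (j := i) (by omega)
      obtain ⟨h2, h3⟩ := hT.of_lt (n := m) (x := y) (by rw [hy.vert_eq le_rfl]; omega)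
      have h4 : T y = x := eq_of_pos_eq (h2.trans hy) (by omega)
      rw [← h4, ← add_assoc]
      exact (hgT y).trans ((ih y hyi).add_right 1)
  have hxm : T xmax = xmin := hmin' _ (hT.2 xmax hmax)
  have : Nonempty B.PathSpace := ⟨xmin⟩
  refine ⟨m, hnm, isUniformlyOrderedBetween_of_period hnm (p := q) (fun w => ?_)
    fun x y hxy => ?_⟩
  · obtain ⟨x, rfl⟩ := exists_path_vert w
    have h0 := height_pos (x.vert m)
    obtain ⟨z, hz, hzp⟩ := exists_pos_eq (n := m) x (j := B.height m (x.vert m) - 1) (by omega)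
    -- compare the value of `g` at the top of the tower with the one at the maximal path
    have hz1 : pos m z + 1 = B.height m (x.vert m) := by omega
    have h1 := (hgT xmax).symm.trans (by rw [hxm])
    rw [← hm1 z (by rw [hz.vert_eq le_rfl]; exact hz1)] at h1
    have h2 : g xmin + B.height m (x.vert m) ≡ g xmin + 0 [MOD q] := by
      rw [← hz1, ← add_assoc]
      exact ((key _ z rfl).add_right 1).symm.trans h1
    exact (Nat.modEq_zero_iff_dvd).1 (Nat.ModEq.add_left_cancel' _ h2)
  · have h1 : pos m x ≡ pos m y [MOD q] := hxy
    have h2 := ((key _ x rfl).trans (h1.add_left _)).trans (key _ y rfl).symm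
    exact hgn x y (h2.eq_of_lt_of_lt (hgq x) (hgq y))

theorem hasUniformlyOrderedTelescoping_of_forall
    (h : ∀ n, ∃ m, ∃ hnm : n < m, B.IsUniformlyOrderedBetween hnm) :
    B.HasUniformlyOrderedTelescoping := by
  choose f hf hf' using h
  -- defined by `Nat.rec` so that `φ (k + 1)` is `f (φ k)` by definition
  let φ : ℕ → ℕ := fun k => Nat.rec 0 (fun _ n => f n) k
  have hφ : StrictMono φ := strictMono_nat_of_lt_succ fun k => hf (φ k)
  refine ⟨φ, hφ, rfl, ?_⟩
  have : {n | (B.telescope φ hφ rfl).IsUniformlyOrderedLevel n} = Set.univ :=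
    Set.eq_univ_of_forall fun k => hf' (φ k)
  rw [this]
  exact Set.infinite_univ

/-- Levels at which the tower heights are multiples of given moduli, each dividing the next, such
that the residues of the positions determine the path. -/
structure Periods (B : OrderedBratteliDiagram.{u}) where
  level : ℕ → ℕ
  modulus : ℕ → ℕ
  modulus_zero : modulus 0 = 1
  modulus_pos : ∀ k, 0 < modulus k
  modulus_dvd : ∀ k, modulus k ∣ modulus (k + 1)
  level_le : ∀ k, level k ≤ level (k + 1)
  dvd_height : ∀ k v, modulus k ∣ B.height (level k) v
  agreeBelow : ∀ k (x y : B.PathSpace),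
    pos (level (k + 1)) x % modulus (k + 1) = pos (level (k + 1)) y % modulus (k + 1) →
      AgreeBelow k x y

theorem HasUniformlyOrderedTelescoping.nonempty_periods [Nonempty B.PathSpace]
    (h : B.HasUniformlyOrderedTelescoping) : Nonempty B.Periods := by
  obtain ⟨φ, hφ, h0, hinf⟩ := h
  have key : ∀ N, ∃ m p, N < m ∧ 0 < p ∧ (∀ w, p ∣ B.height m w) ∧
      (∀ q, (∀ v, q ∣ B.height N v) → q ∣ p) ∧
      ∀ x y : B.PathSpace, pos m x % p = pos m y % p → AgreeBelow N x y := by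
    intro N
    obtain ⟨k, hk, hNk⟩ := hinf.exists_gt N
    have hN : N ≤ φ k := hNk.le.trans hφ.le_apply
    obtain ⟨p, hp, hdvd, hq, hagree⟩ := IsUniformlyOrderedBetween.exists_period
      ((isUniformlyOrderedLevel_telescope_iff hφ h0 k).1 hk)
    refine ⟨φ (k + 1), p, hN.trans_lt (hφ k.lt_succ_self), hp, hdvd, fun q hqN => hq q fun v => ?_,
      fun x y hxy => (hagree x y hxy).mono hN⟩
    obtain ⟨x, rfl⟩ := exists_path_vert v
    exact (pos_mod_eq hN hqN x).1
  choose m p hm hp hdvd hq hagree using key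
  let a : ℕ → ℕ := fun k => Nat.rec 0 (fun _ n => m n) k
  have ha : StrictMono a := strictMono_nat_of_lt_succ fun k => hm (a k)
  let P : ℕ → ℕ := fun k => Nat.rec 1 (fun k _ => p (a k)) k
  have hdvd' : ∀ k v, P k ∣ B.height (a k) v := by
    intro k
    cases k with
    | zero => exact fun v => one_dvd _
    | succ k => exact hdvd (a k)
  refine ⟨⟨a, P, rfl, fun k => ?_, fun k => ?_, fun k => (ha k.lt_succ_self).le, hdvd',
    fun k x y hxy => (hagree (a k) x y hxy).mono ha.le_apply⟩⟩
  · cases k with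
    | zero => exact one_pos
    | succ k => exact hp (a k)
  · exact hq (a k) (P k) (hdvd' k)

namespace Periods

/-- The residue of the position of `x` modulo the `k`-th modulus. -/
noncomputable def residue (P : B.Periods) (k : ℕ) (x : B.PathSpace) : ℕ :=
  pos (P.level k) x % P.modulus k

variable (P : B.Periods)

theorem residue_lt (k : ℕ) (x : B.PathSpace) : P.residue k x < P.modulus k :=
  Nat.mod_lt _ (P.modulus_pos k)

theorem residue_succ_mod (k : ℕ) (x : B.PathSpace) :
    P.residue (k + 1) x % P.modulus k = P.residue k x := by
  rw [residue, Nat.mod_mod_of_dvd _ (P.modulus_dvd k)]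
  exact (pos_mod_eq (P.level_le k) (P.dvd_height k) x).2

theorem residue_congr {k : ℕ} {x y : B.PathSpace} (h : AgreeBelow (P.level k) x y) :
    P.residue k x = P.residue k y := by rw [residue, residue, pos_congr h]

theorem eq_of_residue_eq {x y : B.PathSpace} (h : ∀ k, P.residue k x = P.residue k y) : x = y :=
  PathSpace.ext fun k => P.agreeBelow (k + 1) x y (h (k + 2)) k k.lt_succ_self

theorem exists_residue_eq [Nonempty B.PathSpace] {k j : ℕ} (hj : j < P.modulus k) :
    ∃ x, P.residue k x = j := by
  obtain ⟨x⟩ := ‹Nonempty B.PathSpace›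
  have hle := Nat.le_of_dvd (height_pos _) (P.dvd_height k (x.vert (P.level k)))
  obtain ⟨z, -, hz⟩ := exists_pos_eq x (hj.trans_le hle)
  exact ⟨z, by rw [residue, hz, Nat.mod_eq_of_lt hj]⟩

theorem residue_adic {T : B.PathSpace → B.PathSpace} (hT : B.IsAdicMap T) (k : ℕ)
    (x : B.PathSpace) : P.residue k (T x) = (P.residue k x + 1) % P.modulus k := by
  rw [residue, residue, Nat.mod_add_mod]
  exact hT.pos_modEq (P.dvd_height k) x

/-- Minimal paths have residues `0` and maximal paths have residues `-1`. -/
theorem isProperlyOrdered (P : B.Periods) [CompactSpace B.PathSpace] [Nonempty B.PathSpace] :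
    B.IsProperlyOrdered := by
  obtain ⟨xmax, hmax⟩ := exists_isMaxPath (B := B)
  obtain ⟨xmin, hmin⟩ := exists_isMinPath (B := B)
  refine ⟨⟨xmax, hmax, fun y hy => P.eq_of_residue_eq fun k => ?_⟩,
    ⟨xmin, hmin, fun y hy => P.eq_of_residue_eq fun k => ?_⟩⟩
  · have h1 : ∀ x, B.IsMaxPath x → pos (P.level k) x + 1 ≡ 0 [MOD P.modulus k] := by
      intro x hx
      rw [isMaxPath_iff.1 hx]
      exact (Nat.modEq_zero_iff_dvd).2 (P.dvd_height k _)
    exact Nat.ModEq.add_right_cancel' 1 ((h1 y hy).trans (h1 xmax hmax).symm)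
  · rw [residue, residue, isMinPath_iff.1 hy, isMinPath_iff.1 hmin]

end Periods

end OrderedBratteliDiagram

/-! ### The odometer and the conjugacy -/

namespace OrderedBratteliDiagram

open BratteliDiagram BratteliDiagram.PathSpace Topology

/-- The diagram with one vertex at every level and `q n` edges from level `n` to level `n + 1`, in
their usual order. -/
def odometer (q : ℕ → ℕ) (hq : ∀ n, 0 < q n) : OrderedBratteliDiagram.{u} where
  V _ := PUnit
  E n := ULift (Fin (q n))
  src _ _ := PUnit.unit
  rng _ _ := PUnit.unit
  src_surjective n v := ⟨⟨⟨0, hq n⟩⟩, rfl⟩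
  rng_surjective n v := ⟨⟨⟨0, hq n⟩⟩, rfl⟩
  finite_V _ := inferInstance
  finite_E _ := inferInstance
  card_root := by simp
  lt _ e f := e.down < f.down
  rng_eq_of_lt _ _ _ _ := rfl
  lt_irrefl _ _ := _root_.lt_irrefl _
  lt_trans _ _ _ _ := _root_.lt_trans
  lt_total _ e f _ := by
    rcases lt_trichotomy e.down f.down with h | h | h
    · exact Or.inl h
    · exact Or.inr (Or.inl (ULift.ext _ _ h))
    · exact Or.inr (Or.inr h)

namespace Odometer

variable {q : ℕ → ℕ} {hq : ∀ n, 0 < q n}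

/-- The edge of a path from level `n` to level `n + 1`, as a digit. -/
def digit (y : (odometer.{u} q hq).PathSpace) (n : ℕ) : ℕ :=
  (show ULift.{u} (Fin (q n)) from y.1 n).down

theorem digit_lt (y : (odometer.{u} q hq).PathSpace) (n : ℕ) : digit y n < q n :=
  (show ULift.{u} (Fin (q n)) from y.1 n).down.2

theorem eq_of_digit_eq {y z : (odometer.{u} q hq).PathSpace} {n : ℕ} (h : digit y n = digit z n) :
    y.1 n = z.1 n := ULift.ext _ _ (Fin.ext h)

/-- The number `∑ k < n, yₖ q₀ ⋯ qₖ₋₁` represented by the first `n` digits of a path. -/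
def val (n : ℕ) (y : (odometer.{u} q hq).PathSpace) : ℕ :=
  ∑ k ∈ Finset.range n, digit y k * ∏ i ∈ Finset.range k, q i

theorem val_zero (y : (odometer.{u} q hq).PathSpace) : val 0 y = 0 := by simp [val]

theorem val_succ (n : ℕ) (y : (odometer.{u} q hq).PathSpace) :
    val (n + 1) y = val n y + digit y n * ∏ i ∈ Finset.range n, q i := by
  rw [val, Finset.sum_range_succ, ← val]

theorem weight_pos (hq : ∀ n, 0 < q n) (n : ℕ) : 0 < ∏ i ∈ Finset.range n, q i :=
  Finset.prod_pos fun i _ => hq i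

theorem val_lt (n : ℕ) (y : (odometer.{u} q hq).PathSpace) :
    val n y < ∏ i ∈ Finset.range n, q i := by
  induction n with
  | zero => simp [val_zero]
  | succ n ih =>
    rw [val_succ, Finset.prod_range_succ]
    have := Nat.mul_le_mul_left (∏ i ∈ Finset.range n, q i) (Nat.succ_le_of_lt (digit_lt y n))
    rw [Nat.mul_succ, Nat.mul_comm _ (digit y n)] at this
    omega

theorem val_succ_mod (n : ℕ) (y : (odometer.{u} q hq).PathSpace) :
    val (n + 1) y % ∏ i ∈ Finset.range n, q i = val n y := by
  rw [val_succ, Nat.add_mul_mod_self_right, Nat.mod_eq_of_lt (val_lt n y)]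

theorem agreeBelow_of_val_eq {n : ℕ} {y z : (odometer.{u} q hq).PathSpace} (h : val n y = val n z) :
    AgreeBelow n y z := by
  induction n with
  | zero => exact fun k hk => absurd hk (Nat.not_lt_zero k)
  | succ n ih =>
    have h1 : val n y = val n z := by rw [← val_succ_mod, h, val_succ_mod]
    intro k hk
    rcases (Nat.lt_succ_iff.1 hk).lt_or_eq with hk | rfl
    · exact ih h1 k hk
    · rw [val_succ, val_succ, h1, Nat.add_left_cancel_iff] at h
      exact eq_of_digit_eq (Nat.eq_of_mul_eq_mul_right (weight_pos hq k) h)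

theorem val_lt_val {n : ℕ} {y z : (odometer.{u} q hq).PathSpace} (h : AgreeFrom n y z)
    (hyz : PathLt _ y z) : val n y < val n z := by
  obtain ⟨i, hi, hi'⟩ := hyz
  have hin : i < n := by
    by_contra hin
    rw [h i (not_lt.1 hin)] at hi
    exact (odometer q hq).lt_irrefl _ _ hi
  refine Nat.le_induction ?_ (fun k hk ih => ?_) n (Nat.succ_le_of_lt hin)
  · have h1 : digit y i + 1 ≤ digit z i := hi
    have h2 := Nat.mul_le_mul_right (∏ j ∈ Finset.range i, q j) h1
    have h3 := val_lt i y
    rw [Nat.succ_mul] at h2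
    rw [Nat.succ_eq_add_one, val_succ, val_succ]
    omega
  · have h1 : digit y k = digit z k := by rw [digit, hi' k hk]; rfl
    rw [val_succ, val_succ, h1]
    omega

theorem pathLt_iff_val {n : ℕ} {y z : (odometer.{u} q hq).PathSpace} (h : AgreeFrom n y z) :
    PathLt _ y z ↔ val n y < val n z := by
  refine ⟨val_lt_val h, fun hlt => ?_⟩
  rcases PathLt.total h with h1 | rfl | h1
  · exact h1
  · exact absurd hlt (Nat.lt_irrefl _)
  · exact absurd (val_lt_val h.symm h1) hlt.asymm

theorem exists_digit_eq {d : ℕ → ℕ} (hd : ∀ n, d n < q n) :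
    ∃ y : (odometer.{u} q hq).PathSpace, ∀ n, digit y n = d n :=
  ⟨⟨fun n => ⟨⟨d n, hd n⟩⟩, fun _ => rfl⟩, fun _ => rfl⟩

/-- A compatible sequence of residues is represented by a path. -/
theorem exists_val_eq {r : ℕ → ℕ} (hr : ∀ n, r n < ∏ i ∈ Finset.range n, q i)
    (hr' : ∀ n, r (n + 1) % ∏ i ∈ Finset.range n, q i = r n) :
    ∃ y : (odometer.{u} q hq).PathSpace, ∀ n, val n y = r n := by
  have hlt : ∀ n, r (n + 1) / ∏ i ∈ Finset.range n, q i < q n := fun n =>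
    Nat.div_lt_of_lt_mul (by rw [← Finset.prod_range_succ]; exact hr (n + 1))
  obtain ⟨y, hy⟩ := exists_digit_eq (hq := hq) hlt
  refine ⟨y, fun n => ?_⟩
  induction n with
  | zero =>
    have := hr 0
    rw [Finset.prod_range_zero] at this
    rw [val_zero]
    omega
  | succ n ih =>
    rw [val_succ, ih, hy, ← hr' n]
    exact Nat.mod_add_div' _ _

/-- A map that adds `1` to the numbers represented by the digits is the adic map. -/
theorem isAdicMap_of_val {S : (odometer.{u} q hq).PathSpace → (odometer.{u} q hq).PathSpace}
    (hS : ∀ n y, val n (S y) = (val n y + 1) % ∏ i ∈ Finset.range n, q i) :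
    IsAdicMap _ S := by
  refine ⟨fun y hy => ?_, fun y hy n e he => ?_⟩
  -- a path that is not maximal has a level from which on adding `1` causes no carry
  · obtain ⟨n, hn⟩ : ∃ n, val n y + 1 < ∏ i ∈ Finset.range n, q i := by
      unfold IsMaxPath at hy
      push Not at hy
      obtain ⟨n, e, he⟩ := hy
      refine ⟨n + 1, ?_⟩
      have h1 : digit y n + 2 ≤ q n :=
        Nat.succ_le_of_lt (lt_of_le_of_lt (Nat.succ_le_of_lt he) e.down.2)
      have h2 := Nat.mul_le_mul_right (∏ i ∈ Finset.range n, q i) h1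
      have h3 := val_lt n y
      rw [val_succ, Finset.prod_range_succ, Nat.mul_comm _ (q n)]
      rw [Nat.add_mul] at h2
      omega
    have hle : ∀ m, n ≤ m → val m y + 1 < ∏ i ∈ Finset.range m, q i := by
      intro m hm
      induction m, hm using Nat.le_induction with
      | base => exact hn
      | succ m _ ih =>
        have h2 := Nat.mul_le_mul_right (∏ i ∈ Finset.range m, q i)
          (Nat.succ_le_of_lt (digit_lt y m))
        rw [Nat.succ_mul] at h2
        rw [val_succ, Finset.prod_range_succ, Nat.mul_comm _ (q m)]
        omega
    have hS' : ∀ m, n ≤ m → val m (S y) = val m y + 1 := fun m hm => by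
      rw [hS, Nat.mod_eq_of_lt (hle m hm)]
    have hfrom : AgreeFrom n (S y) y := by
      intro m hm
      have h1 := hS' (m + 1) (hm.trans m.le_succ)
      rw [val_succ, val_succ, hS' m hm] at h1
      exact eq_of_digit_eq (Nat.eq_of_mul_eq_mul_right (weight_pos hq m) (by omega))
    have hlt : PathLt _ y (S y) := by
      rw [pathLt_iff_val hfrom.symm, hS' n le_rfl]
      exact Nat.lt_succ_self _
    refine ⟨hlt, fun z hz => ?_⟩
    obtain ⟨k, hk⟩ := hz.exists_agreeFrom
    have h1 := hk.mono (le_max_right n k)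
    have h2 := (hfrom.mono (le_max_left n k)).trans h1
    have h3 := val_lt_val h1 hz
    have h4 := hS' _ (le_max_left n k)
    rw [pathLt_iff_val h2]
    rcases (Nat.succ_le_of_lt h3).lt_or_eq with h5 | h5
    · exact Or.inr (by omega)
    · exact Or.inl (eq_of_agree (agreeBelow_of_val_eq (by omega)) h2.symm)
  · have htop : ∀ m, val m y + 1 = ∏ i ∈ Finset.range m, q i := by
      intro m
      induction m with
      | zero => simp [val_zero]
      | succ m ih =>
        have h1 : digit y m + 1 = q m := by
          by_contra hne
          have h2 : digit y m + 1 < q m := lt_of_le_of_ne (digit_lt y m) hne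
          exact hy m ⟨⟨_, h2⟩⟩ (Nat.lt_succ_self (digit y m))
        rw [val_succ, Finset.prod_range_succ, ← h1, Nat.mul_succ, Nat.mul_comm _ (digit y m)]
        omega
    have h1 := hS (n + 1) y
    rw [htop, Nat.mod_self, val_succ] at h1
    have h2 : digit (S y) n = 0 :=
      (Nat.mul_eq_zero.1 (Nat.eq_zero_of_add_eq_zero h1).2).resolve_right (weight_pos hq n).ne'
    have h3 : (show ULift.{u} (Fin (q n)) from e).down.1 < digit (S y) n := he
    omega

end Odometer

variable {B : OrderedBratteliDiagram.{u}}

open Odometer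

theorem Periods.isConjugateToOdometer (P : B.Periods) [CompactSpace B.PathSpace]
    [Nonempty B.PathSpace] (hB : B.HasCantorPathSpace) : B.IsConjugateToOdometer := by
  obtain ⟨T, hT⟩ := P.isProperlyOrdered.exists_isAdicHomeomorph
  let q : ℕ → ℕ := fun n => P.modulus (n + 1) / P.modulus n
  have hq : ∀ n, 0 < q n := fun n =>
    Nat.div_pos (Nat.le_of_dvd (P.modulus_pos _) (P.modulus_dvd n)) (P.modulus_pos n)
  have hw : ∀ n, ∏ i ∈ Finset.range n, q i = P.modulus n := by
    intro n
    induction n with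
    | zero => rw [Finset.prod_range_zero, P.modulus_zero]
    | succ n ih => rw [Finset.prod_range_succ, ih, Nat.mul_div_cancel' (P.modulus_dvd n)]
  have hex : ∀ x : B.PathSpace, ∃ y : (odometer.{u} q hq).PathSpace,
      ∀ n, val n y = P.residue n x := fun x =>
    exists_val_eq (fun n => hw n ▸ P.residue_lt n x) fun n => hw n ▸ P.residue_succ_mod n x
  -- the residues of `x` are the numbers represented by the digits of `f x`
  choose f hf using hex
  have hinj : Function.Injective f := fun x x' h =>
    P.eq_of_residue_eq fun k => by rw [← hf, ← hf, h]
  have hsurj : Function.Surjective f := by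
    intro y
    obtain ⟨x, hx⟩ := exists_mem_of_antitone (B := B.toBratteliDiagram)
      (Z := fun k => {x | P.residue k x = val k y})
      (antitone_nat_of_succ_le fun k x hx => by
        have hx' : P.residue (k + 1) x = val (k + 1) y := hx
        change P.residue k x = val k y
        rw [← P.residue_succ_mod, hx', ← hw, val_succ_mod])
      (fun k => isClosed_of_agreeBelow (P.level k) fun x x' h hx =>
        (P.residue_congr h).symm.trans hx)
      (fun k => P.exists_residue_eq (hw k ▸ val_lt k y))
    refine ⟨x, PathSpace.ext fun k => ?_⟩
    exact agreeBelow_of_val_eq (n := k + 1) ((hf x _).trans (hx _)) k k.lt_succ_self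
  have hcont : Continuous f := by
    refine PathSpace.continuous_iff.2 fun n x => ?_
    filter_upwards [agreeBelow_mem_nhds (P.level n) x] with x' hx'
    exact agreeBelow_of_val_eq (by rw [hf, hf, P.residue_congr hx'])
  let h : B.PathSpace ≃ₜ (odometer.{u} q hq).PathSpace :=
    hcont.homeoOfEquivCompactToT2 (f := Equiv.ofBijective f ⟨hinj, hsurj⟩)
  have hh : ∀ n x, val n (h x) = P.residue n x := fun n x => hf x n
  -- the adic homeomorphism of the odometer is the one of `B`, transported along `h`
  refine ⟨odometer q hq, hB.map h.symm.trans, fun n => ?_, T, (h.symm.trans T).trans h, h, hT, ?_,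
    fun x => ?_⟩
  · change Nat.card PUnit = 1
    simp
  · refine isAdicMap_of_val fun n y => ?_
    obtain ⟨x, rfl⟩ := h.surjective y
    simp only [Homeomorph.trans_apply, Homeomorph.symm_apply_apply]
    rw [hh, hh, hw]
    exact P.residue_adic hT n x
  · simp

end OrderedBratteliDiagram

theorem theorem5p2 (B : OrderedBratteliDiagram.{u}) (hB : B.HasCantorPathSpace) :
    (B.HasUniformlyOrderedTelescoping → B.IsProperlyOrdered ∧ B.IsConjugateToOdometer) ∧
    (B.IsSimple → B.IsProperlyOrdered → B.IsConjugateToOdometer →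
      B.HasUniformlyOrderedTelescoping) := by
  obtain ⟨e⟩ := id hB
  have : CompactSpace B.PathSpace := e.symm.compactSpace
  have : Nonempty B.PathSpace := ⟨e.symm fun _ => false⟩
  refine ⟨fun h => ?_, fun _ hproper hodo => ?_⟩
  · obtain ⟨P⟩ := h.nonempty_periods
    exact ⟨P.isProperlyOrdered, P.isConjugateToOdometer hB⟩
  · obtain ⟨C, ⟨e'⟩, hC, hBC⟩ := hodo
    have : CompactSpace C.PathSpace := e'.symm.compactSpace
    exact OrderedBratteliDiagram.hasUniformlyOrderedTelescoping_of_forall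
      (OrderedBratteliDiagram.exists_isUniformlyOrderedBetween hproper hC hBC)
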